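/- Let $\mathbb S^1=\mathbb R/2\pi\mathbb Z$, let $\langle f\rangle=\frac1{2\pi}\int_{\mathbb S^1}f\,dx$ and $\hat f(k)=\frac1{2\pi}\int_{\mathbb S^1} f(x)e^{-ikx}\,dx$, and for $\alpha\ge 0$ let $A^\alpha(\mathbb S^1)$ be the space of $f\in L^1(\mathbb S^1)$ with $\|f\|_{A^\alpha}=\sum_{k\in\mathbb Z}|k|^\alpha|\hat f(k)|<\infty$. Consider the equation $$\partial_t u-\partial_x\arctan\left(\frac{\partial_x u}{u}\right)=0,\qquad u(\cdot,0)=u_0. \tag{1}$$ A positive solution of (1) on $[0,T)$, $0<T\le\infty$, is a function $u>0$ on $[0,T)\times\mathbb S^1$ such that $u$ and $\partial_x u$ are continuous on $[0,T)\times\mathbb S^1$, $u(\cdot,0)=u_0$ almost everywhere, and $$\int_{\mathbb S^1}u(x,t)\varphi(x)\,dx=\int_{\mathbb S^1}u_0\varphi\,dx-\int_0^t\int_{\mathbb S^1}\arctan\left(\frac{\partial_xu}{u}\right)\partial_x\varphi\,dx\,ds$$ for all $\varphi\in C^\infty(\mathbb S^1)$ and $t\in[0,T)$. (Every positive solution in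 $C([0,T);H^3(\mathbb S^1))$ is of this kind.) **Theorem.** Let $u_0\in L^1(\mathbb S^1)$ be real valued with $\langle u_0\rangle>0$, and suppose that $w_0=\frac{u_0-\langle u_0\rangle}{\langle u_0\rangle}\in A^1(\mathbb S^1)$ with $\|w_0\|_{A^1}<\frac1{10}$. Then (1) has a positive solution on $[0,\infty)$; for every $0<T\le\infty$ there is at most one positive solution on $[0,T)$; and if $u$ is the positive solution on $[0,T)$, $0<T\le\infty$, then $w=\frac{u-\langle u_0\rangle}{\langle u_0\rangle}$ satisfies $$w\in L^\infty(0,T;A^1(\mathbb S^1))\cap L^1(0,T;A^3(\mathbb S^1)).$$ -/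

import Mathlib

open MeasureTheory Set
open scoped ENNReal

noncomputable section

namespace ArctanDiffusion

instance fact_two_pi_pos : Fact (0 < 2 * Real.pi) := ⟨Real.two_pi_pos⟩

/-- The circle `ℝ / 2πℤ`. Mathlib's `volume` on it has total mass `2π`, and `fourierCoeff f k` is
`(2π)⁻¹ ∫ f(x) e^{-ikx} dx`. -/
abbrev S1 : Type := AddCircle (2 * Real.pi)

/-- The spatial derivative of a function on the circle. -/
def xDeriv (f : S1 → ℝ) (x : S1) : ℝ := deriv (fun h : ℝ => f (x + (h : S1))) 0

/-- The Fourier coefficients of a real function on the circle. -/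
def fourierC (f : S1 → ℝ) (k : ℤ) : ℂ := fourierCoeff (fun x : S1 => (f x : ℂ)) k

/-- The homogeneous Wiener norm `∑ₖ |k|^α |f̂(k)|`, with values in `[0, ∞]`. -/
def wienerNorm (α : ℕ) (f : S1 → ℝ) : ℝ≥0∞ :=
  ∑' k : ℤ, ENNReal.ofReal (|(k : ℝ)| ^ α * ‖fourierC f k‖)

/-- Membership in the Wiener space `A^α(S¹)`. -/
def MemWiener (α : ℕ) (f : S1 → ℝ) : Prop :=
  Integrable f ∧ wienerNorm α f < ⊤

/-- The time interval `[0, T)`, where `T = ∞` is allowed. -/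
def timeIco (T : ℝ≥0∞) : Set ℝ := {t | 0 ≤ t ∧ ENNReal.ofReal t < T}

/-- The time interval `(0, T)`, where `T = ∞` is allowed. -/
def timeIoo (T : ℝ≥0∞) : Set ℝ := {t | 0 < t ∧ ENNReal.ofReal t < T}

/-- `w ∈ L^p(0, T; A^α(S¹))`. Since `A^α` is separable, and its elements are determined by their
Fourier coefficients, measurability in time is measurability of each Fourier coefficient. -/
structure MemLpWiener (p : ℝ≥0∞) (T : ℝ≥0∞) (α : ℕ) (w : ℝ → S1 → ℝ) : Prop where
  aemeasurable : ∀ k : ℤ,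
    AEMeasurable (fun t => fourierC (w t) k) (volume.restrict (timeIoo T))
  mem : ∀ᵐ t ∂(volume.restrict (timeIoo T)), MemWiener α (w t)
  norm_lt_top : eLpNorm (fun t => wienerNorm α (w t)) p (volume.restrict (timeIoo T)) < ⊤

/-- `u` is a positive solution on `[0, T)` of `∂ₜu - ∂ₓ arctan(∂ₓu / u) = 0` with initial datum
`u₀`: `u` is positive, `u` and `∂ₓu` are continuous on `[0, T) × S¹`, and the equation holds in its
time-integrated form, tested against smooth functions of `x`. -/
structure IsPositiveSolution (u₀ : S1 → ℝ) (T : ℝ≥0∞) (u : ℝ → S1 → ℝ) : Prop where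
  pos : ∀ t ∈ timeIco T, ∀ x, 0 < u t x
  continuousOn : ContinuousOn (fun q : ℝ × S1 => u q.1 q.2) (timeIco T ×ˢ univ)
  differentiable : ∀ t ∈ timeIco T, ∀ x : S1,
    DifferentiableAt ℝ (fun h : ℝ => u t (x + (h : S1))) 0
  continuousOn_xDeriv : ContinuousOn (fun q : ℝ × S1 => xDeriv (u q.1) q.2) (timeIco T ×ˢ univ)
  initial : u 0 =ᵐ[volume] u₀
  equation : ∀ φ : S1 → ℝ, ContDiff ℝ (⊤ : ℕ∞) (fun y : ℝ => φ (y : S1)) → ∀ t ∈ timeIco T,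
    ∫ x, u t x * φ x = (∫ x, u₀ x * φ x)
      - ∫ s in (0 : ℝ)..t, ∫ x, Real.arctan (xDeriv (u s) x / u s x) * xDeriv φ x

/-- The relative deviation `(f - ⟨u₀⟩) / ⟨u₀⟩` from the mean `⟨u₀⟩ = (2π)⁻¹ ∫ u₀`. -/
def relDev (u₀ f : S1 → ℝ) (x : S1) : ℝ := (f x - ⨍ y, u₀ y) / ⨍ y, u₀ y

end ArctanDiffusion

end

open ArctanDiffusion

/-!
The equation is parabolic with a hidden holomorphic structure. After rescaling time by the mean,
`w = u / ⟨u₀⟩ - 1` solves `∂ₜw = ∂ₓ arctan (∂ₓw / (1 + w))`, and the flux is `Im log (1 + z)` for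
`z = w + i ∂ₓw`. The unknown is `p = ∂ₓw`. In the Wiener algebra of absolutely convergent Fourier
series, normed by the sum of the moduli of the coefficients, `z` depends linearly on `p` with norm
at most one: the multiplier is `(1 - k) / (ik)`, and the coefficients of a real function at `k` and
`-k` have the same modulus, while `|1 - k| + |1 + k| = 2 |k|` for `k ≠ 0` (`Wiener.norm_zMap_le`).
As `1 + z` is inverted by a Neumann series, `∂ₜp = ∂ₓ²p + N(p)` with
`‖N(p)‖ ≤ x (2 - x) / (1 - x)² * ‖∂ₓ²p‖`, `x = ‖p‖`; only `x ≤ 1/8` is needed, where the bound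
is at most `120/49 * x * ‖∂ₓ²p‖` (`Wiener.norm_nonlin_le`).

*Existence.* For `∂ₜp = ∂ₓ²p + G`, integrating Duhamel's formula for each Fourier mode and summing
over the modes gives `‖p(t)‖ + ∫₀ᵗ ‖∂ₓ²p‖ ≤ ‖p(0)‖ + ∫₀ᵗ ‖G‖`, an `L¹` maximal regularity estimate
without loss (`enorm_heat_add_lintegral_le`). It turns `G ↦ N(p)` into a contraction of a ball of
`L¹((0, ∞); A)`. To stay in the ball with data of size `1/10`, one uses that
`x(t) ≤ r - ∫₀ᵗ ‖∂ₓ²p‖` and hence `∫ x ‖∂ₓ²p‖ ≤ r² / 2` (`two_mul_lintegral_mul_le`), where the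
trivial bound would be `r²`. The fixed point is bounded in the algebra, with `∂ₓ²p` integrable in
time; this is the regularity `L^∞ A¹ ∩ L¹ A³` of `w`. Continuity in time with values in the algebra
gives a positive solution in the required sense.

*Uniqueness.* The Fourier coefficients of the difference `d` of two positive solutions are
continuously differentiable in time, and Parseval's identity gives
`‖d(t)‖² = -2 ∫₀ᵗ ∫ ∂ₓd (arctan (∂ₓu / u) - arctan (∂ₓv / v))`. As `arctan` is increasing, with a
derivative bounded below on compact sets, the inner integrand is at least `-C d²` on compact time
intervals (`flux_monotone`), and Gronwall's inequality applies (`eq_zero_of_energy`). So every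
positive solution is the one constructed, and inherits its regularity.
-/

noncomputable section

namespace ArctanDiffusion

open Filter Topology
open scoped ComplexConjugate

/-! ### The Wiener algebra -/

/-- The Wiener algebra, encoded as the space `ℓ¹(ℤ, ℂ)` of absolutely summable sequences of
Fourier coefficients. Its multiplication is convolution. -/
def Wiener : Type := lp (fun _ : ℤ => ℂ) 1

namespace Wiener

instance : NormedAddCommGroup Wiener := inferInstanceAs (NormedAddCommGroup (lp (fun _ : ℤ => ℂ) 1))
instance : NormedSpace ℂ Wiener := inferInstanceAs (NormedSpace ℂ (lp (fun _ : ℤ => ℂ) 1))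
instance : CompleteSpace Wiener := inferInstanceAs (CompleteSpace (lp (fun _ : ℤ => ℂ) 1))

instance : FunLike Wiener ℤ ℂ where
  coe a := Subtype.val (p := fun c => c ∈ lp (fun _ : ℤ => ℂ) 1) a
  coe_injective := Subtype.val_injective

theorem ext {a b : Wiener} (h : ∀ k, a k = b k) : a = b := DFunLike.ext a b h

/-- The element of the Wiener algebra with given absolutely summable coefficients. -/
def mk (c : ℤ → ℂ) (h : Summable fun k => ‖c k‖) : Wiener :=
  (⟨c, memℓp_gen (by simpa using h)⟩ : lp (fun _ : ℤ => ℂ) 1)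

@[simp] theorem mk_apply (c : ℤ → ℂ) (h : Summable fun k => ‖c k‖) (k : ℤ) : mk c h k = c k := rfl

@[simp] theorem add_apply (a b : Wiener) (k : ℤ) : (a + b) k = a k + b k := rfl
@[simp] theorem sub_apply (a b : Wiener) (k : ℤ) : (a - b) k = a k - b k := rfl
@[simp] theorem neg_apply (a : Wiener) (k : ℤ) : (-a) k = -a k := rfl
@[simp] theorem zero_apply (k : ℤ) : (0 : Wiener) k = 0 := rfl
@[simp] theorem smul_apply (c : ℂ) (a : Wiener) (k : ℤ) : (c • a) k = c * a k := rfl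

theorem hasSum_norm (a : Wiener) : HasSum (fun k => ‖a k‖) ‖a‖ := by
  have h := lp.hasSum_norm (E := fun _ : ℤ => ℂ) (p := 1) (by simp) a
  simp only [ENNReal.toReal_one, Real.rpow_one] at h
  exact h

theorem summable_norm (a : Wiener) : Summable fun k => ‖a k‖ := a.hasSum_norm.summable

theorem norm_eq (a : Wiener) : ‖a‖ = ∑' k, ‖a k‖ := a.hasSum_norm.tsum_eq.symm

theorem norm_coeff_le (a : Wiener) (k : ℤ) : ‖a k‖ ≤ ‖a‖ :=
  le_hasSum a.hasSum_norm k fun _ _ => norm_nonneg _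

open Classical in
/-- The element of the Wiener algebra with given coefficients; by convention `0` if these are not
absolutely summable. -/
def ofCoeff (c : ℤ → ℂ) : Wiener :=
  if h : Summable fun k => ‖c k‖ then mk c h else 0

theorem ofCoeff_apply {c : ℤ → ℂ} (h : Summable fun k => ‖c k‖) (k : ℤ) : ofCoeff c k = c k := by
  rw [ofCoeff, dif_pos h, mk_apply]

theorem norm_ofCoeff {c : ℤ → ℂ} (h : Summable fun k => ‖c k‖) : ‖ofCoeff c‖ = ∑' k, ‖c k‖ := by
  simp [norm_eq, ofCoeff_apply h]

theorem enorm_ofCoeff_le (c : ℤ → ℂ) : ‖ofCoeff c‖ₑ ≤ ∑' k, ‖c k‖ₑ := by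
  by_cases h : Summable fun k => ‖c k‖
  · rw [← ofReal_norm, norm_ofCoeff h, ENNReal.ofReal_tsum_of_nonneg (fun _ => norm_nonneg _) h]
    simp
  · rw [ofCoeff, dif_neg h]; simp

theorem enorm_eq (a : Wiener) : ‖a‖ₑ = ∑' k, ‖a k‖ₑ := by
  rw [← ofReal_norm, norm_eq,
    ENNReal.ofReal_tsum_of_nonneg (fun _ => norm_nonneg _) a.summable_norm]
  simp

/-- The coefficient functionals. -/
def coeffL (k : ℤ) : Wiener →L[ℂ] ℂ :=
  LinearMap.mkContinuous ⟨⟨fun a => a k, fun _ _ => rfl⟩, fun _ _ => rfl⟩ 1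
    fun a => (a.norm_coeff_le k).trans_eq (one_mul _).symm

@[simp] theorem coeffL_apply (k : ℤ) (a : Wiener) : coeffL k a = a k := rfl

/-! #### Evaluation -/

theorem summable_smul_fourier (a : Wiener) :
    Summable fun k => a k • (fourier k : C(S1, ℂ)) := by
  refine Summable.of_norm ?_
  simpa [norm_smul, fourier_norm] using a.summable_norm

/-- The function on the circle with given Fourier coefficients. -/
def ev : Wiener →L[ℂ] C(S1, ℂ) :=
  LinearMap.mkContinuous
    { toFun := fun a => ∑' k, a k • (fourier k : C(S1, ℂ))
      map_add' := fun a b => by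
        rw [← (summable_smul_fourier a).tsum_add (summable_smul_fourier b)]
        simp [add_smul]
      map_smul' := fun c a => by
        simp only [RingHom.id_apply]
        rw [← (summable_smul_fourier a).tsum_const_smul c]
        simp [mul_smul] } 1
    fun a => by
      simp only [LinearMap.coe_mk, AddHom.coe_mk, one_mul]
      refine (norm_tsum_le_tsum_norm ?_).trans ?_
      · simpa [norm_smul, fourier_norm] using a.summable_norm
      · simp [norm_smul, norm_eq, fourier_norm]

theorem hasSum_ev (a : Wiener) (x : S1) : HasSum (fun k => a k * fourier k x) (ev a x) := by
  have h := (summable_smul_fourier a).hasSum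
  exact (ContinuousMap.evalCLM ℂ x).hasSum h

theorem norm_ev_le (a : Wiener) : ‖ev a‖ ≤ ‖a‖ := by
  simpa using LinearMap.mkContinuous_norm_le _ zero_le_one _ |> fun h =>
    (ev.le_opNorm a).trans (mul_le_mul_of_nonneg_right h (norm_nonneg a))

theorem norm_ev_apply_le (a : Wiener) (x : S1) : ‖ev a x‖ ≤ ‖a‖ :=
  ((ev a).norm_coe_le_norm x).trans a.norm_ev_le

theorem fourierCoeff_fourier_eq (j k : ℤ) :
    fourierCoeff (fourier j : S1 → ℂ) k = if k = j then 1 else 0 := by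
  rw [fourierCoeff_fourier]
  simp [Pi.single_apply]

theorem fourierCoeff_ev (a : Wiener) (k : ℤ) : fourierCoeff (ev a) k = a k := by
  -- `fourierCoeff · k` is a continuous linear functional on `C(S1, ℂ)`
  let L : C(S1, ℂ) →ₗ[ℂ] ℂ :=
    { toFun := fun f => fourierCoeff f k
      map_add' := fun f g => by
        have hi : ∀ f : C(S1, ℂ), Integrable f (AddCircle.haarAddCircle (T := 2 * Real.pi)) :=
          fun f => f.continuous.integrable_of_hasCompactSupport
            (HasCompactSupport.of_compactSpace f)
        exact congrFun (fourierCoeff.add (hi f) (hi g)) k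
      map_smul' := fun c f => fourierCoeff.const_smul f c k }
  have hL : ∀ f, ‖L f‖ ≤ 1 * ‖f‖ := fun f => by
    change ‖∫ x, _ ∂_‖ ≤ _
    refine (norm_integral_le_of_norm_le_const (C := ‖f‖) (ae_of_all _ fun x => ?_)).trans (by simp)
    rw [norm_smul]
    calc _ ≤ 1 * ‖f‖ := by
          gcongr
          · exact ((fourier (-k)).norm_coe_le_norm x).trans_eq (fourier_norm _)
          · exact f.norm_coe_le_norm x
      _ = _ := one_mul _
  have h := (L.mkContinuous 1 hL).hasSum (summable_smul_fourier a).hasSum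
  have h2 : (fun j => (L.mkContinuous 1 hL) (a j • (fourier j : C(S1, ℂ))))
      = fun j => if k = j then a k else 0 := by
    funext j
    rw [map_smul]
    change a j * fourierCoeff (fourier j) k = _
    rw [fourierCoeff_fourier_eq]
    split_ifs with hj
    · rw [hj, mul_one]
    · rw [mul_zero]
  rw [h2] at h
  refine h.unique ?_
  simp_rw [eq_comm (a := k)]
  exact hasSum_ite_eq k (a k)

theorem ev_injective : Function.Injective ev := fun a b h =>
  ext fun k => by rw [← fourierCoeff_ev a, ← fourierCoeff_ev b, h]

/-! #### The ring structure -/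

theorem summable_norm_mul (a b : Wiener) :
    Summable fun q : ℤ × ℤ => ‖a q.1 * b (q.2 - q.1)‖ := by
  have h := a.summable_norm.mul_of_nonneg b.summable_norm (fun _ => norm_nonneg _)
    (fun _ => norm_nonneg _)
  let e : ℤ × ℤ ≃ ℤ × ℤ :=
    { toFun := fun q => (q.1, q.2 - q.1)
      invFun := fun q => (q.1, q.2 + q.1)
      left_inv := fun q => by simp
      right_inv := fun q => by simp }
  have h2 := e.summable_iff.mpr h
  simpa [Function.comp_def, e, norm_mul] using h2

/-- The product of two series, with the terms indexed as in a convolution. -/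
theorem hasSum_mul (a b : Wiener) (φ ψ : ℤ → ℂ) (hφ : ∀ k, ‖φ k‖ ≤ 1) (hψ : ∀ k, ‖ψ k‖ ≤ 1) :
    HasSum (fun q : ℤ × ℤ => (a q.1 * φ q.1) * (b (q.2 - q.1) * ψ (q.2 - q.1)))
      ((∑' k, a k * φ k) * ∑' k, b k * ψ k) := by
  have key : ∀ (a : Wiener) (φ : ℤ → ℂ), (∀ k, ‖φ k‖ ≤ 1) → Summable fun k => ‖a k * φ k‖ :=
    fun a φ hφ => a.summable_norm.of_nonneg_of_le (fun _ => norm_nonneg _) fun k => by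
      rw [norm_mul]; exact mul_le_of_le_one_right (norm_nonneg _) (hφ k)
  have h1 := (summable_mul_of_summable_norm (key a φ hφ) (key b ψ hψ)).hasSum
  rw [← tsum_mul_tsum_of_summable_norm (key a φ hφ) (key b ψ hψ)] at h1
  let e : ℤ × ℤ ≃ ℤ × ℤ :=
    { toFun := fun q => (q.1, q.2 - q.1)
      invFun := fun q => (q.1, q.2 + q.1)
      left_inv := fun q => by simp
      right_inv := fun q => by simp }
  exact e.hasSum_iff.mpr h1

theorem summable_conv (a b : Wiener) : Summable fun k => ‖∑' j, a j * b (k - j)‖ := by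
  have h := (summable_norm_mul a b).prod_symm
  refine Summable.of_nonneg_of_le (fun _ => norm_nonneg _) (fun k => ?_) h.prod
  exact norm_tsum_le_tsum_norm (h.prod_factor k)

instance : Mul Wiener := ⟨fun a b => ofCoeff fun k => ∑' j, a j * b (k - j)⟩

theorem mul_apply (a b : Wiener) (k : ℤ) : (a * b) k = ∑' j, a j * b (k - j) :=
  ofCoeff_apply (summable_conv a b) k

theorem norm_mul_le' (a b : Wiener) : ‖a * b‖ ≤ ‖a‖ * ‖b‖ := by
  have h := (summable_norm_mul a b).prod_symm
  have h1 : ‖a‖ * ‖b‖ = ∑' k, ∑' j, ‖a j * b (k - j)‖ := by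
    refine Eq.trans ?_ (h.tsum_prod' h.prod_factor)
    rw [norm_eq a, norm_eq b, a.summable_norm.tsum_mul_tsum b.summable_norm
      (a.summable_norm.mul_of_nonneg b.summable_norm (fun _ => norm_nonneg _)
      (fun _ => norm_nonneg _))]
    let e : ℤ × ℤ ≃ ℤ × ℤ :=
      { toFun := fun q => (q.2, q.1 - q.2)
        invFun := fun q => (q.2 + q.1, q.1)
        left_inv := fun q => by simp
        right_inv := fun q => by simp }
    rw [← e.tsum_eq]
    simp [e]
  rw [h1, norm_eq]
  refine Summable.tsum_le_tsum (fun k => ?_) ?_ h.prod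
  · rw [mul_apply]; exact norm_tsum_le_tsum_norm (h.prod_factor k)
  · exact (a * b).summable_norm

theorem ev_mul' (a b : Wiener) : ev (a * b) = ev a * ev b := by
  ext x
  have h := hasSum_mul a b (fun k => fourier k x) (fun k => fourier k x)
    (fun k => ((fourier k).norm_coe_le_norm x).trans_eq (fourier_norm _))
    (fun k => ((fourier k).norm_coe_le_norm x).trans_eq (fourier_norm _))
  have h2 := (hasSum_ev (a * b) x).tsum_eq
  rw [ContinuousMap.mul_apply, ← h2, ← (hasSum_ev a x).tsum_eq, ← (hasSum_ev b x).tsum_eq,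
    ← h.tsum_eq]
  have hs := h.summable.prod_symm
  rw [← (Equiv.prodComm ℤ ℤ).tsum_eq]
  refine Eq.trans ?_ hs.tsum_prod.symm
  refine tsum_congr fun k => ?_
  rw [mul_apply, ← tsum_mul_right]
  refine tsum_congr fun j => ?_
  simp only [Prod.swap_prod_mk]
  have : (fourier k x : ℂ) = fourier j x * fourier (k - j) x := by rw [← fourier_add]; simp
  rw [this]; ring

instance : One Wiener := ⟨ofCoeff fun k => if k = 0 then 1 else 0⟩

theorem summable_one : Summable fun k : ℤ => ‖(if k = 0 then 1 else 0 : ℂ)‖ :=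
  summable_of_ne_finset_zero (s := {0}) fun k hk => by simp_all

theorem one_apply (k : ℤ) : (1 : Wiener) k = if k = 0 then 1 else 0 :=
  ofCoeff_apply summable_one k

theorem norm_one' : ‖(1 : Wiener)‖ = 1 := by
  rw [norm_eq, tsum_eq_single 0 fun k hk => by simp [one_apply, hk]]
  simp [one_apply]

theorem ev_one' : ev 1 = 1 := by
  ext x
  rw [← (hasSum_ev 1 x).tsum_eq, tsum_eq_single 0 fun k hk => by simp [one_apply, hk]]
  simp [one_apply]

instance : NormedCommRing Wiener :=
  { (inferInstance : NormedAddCommGroup Wiener) with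
    mul := (· * ·)
    one := 1
    left_distrib := fun a b c => ev_injective (by simp only [ev_mul', map_add, mul_add])
    right_distrib := fun a b c => ev_injective (by simp only [ev_mul', map_add, add_mul])
    zero_mul := fun a => ev_injective (by simp only [ev_mul', map_zero, zero_mul])
    mul_zero := fun a => ev_injective (by simp only [ev_mul', map_zero, mul_zero])
    mul_assoc := fun a b c => ev_injective (by simp only [ev_mul', mul_assoc])
    one_mul := fun a => ev_injective (by simp only [ev_mul', ev_one', one_mul])
    mul_one := fun a => ev_injective (by simp only [ev_mul', ev_one', mul_one])
    mul_comm := fun a b => ev_injective (by simp only [ev_mul', mul_comm])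
    dist_eq := fun a b => dist_eq_norm_neg_add a b
    norm_mul_le := norm_mul_le' }

instance : NormOneClass Wiener := ⟨norm_one'⟩

@[simp] theorem ev_mul (a b : Wiener) : ev (a * b) = ev a * ev b := ev_mul' a b
@[simp] theorem ev_one : ev 1 = 1 := ev_one'

end Wiener

/-! ### Calculus on the circle -/

theorem S1.hasDerivAt_iff {E : Type*} [NormedAddCommGroup E] [NormedSpace ℝ E] {f : S1 → E} {e : E}
    {y : ℝ} : HasDerivAt (fun h : ℝ => f ((y : S1) + (h : S1))) e 0 ↔
      HasDerivAt (fun z : ℝ => f (z : S1)) e y := by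
  constructor <;> intro h
  · have h2 := HasDerivAt.comp_const_add (f := fun h : ℝ => f ((y : S1) + (h : S1))) (-y) y
      (by simpa using h)
    simpa [← AddCircle.coe_add] using h2
  · have h2 := HasDerivAt.comp_const_add (f := fun z : ℝ => f (z : S1)) y 0 (by simpa using h)
    simpa [AddCircle.coe_add] using h2

theorem integral_S1 {E : Type*} [NormedAddCommGroup E] [NormedSpace ℝ E] (f : S1 → E) :
    ∫ x, f x = ∫ y in (0 : ℝ)..(2 * Real.pi), f (y : S1) := by
  simpa using (AddCircle.intervalIntegral_preimage (2 * Real.pi) 0 f).symm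

theorem integral_derivative_eq_zero {E : Type*} [NormedAddCommGroup E] [NormedSpace ℝ E]
    [CompleteSpace E] {f g : S1 → E} (hg : Continuous g)
    (h : ∀ y : ℝ, HasDerivAt (fun z : ℝ => f (z : S1)) (g (y : S1)) y) : ∫ x, g x = 0 := by
  rw [integral_S1, intervalIntegral.integral_eq_sub_of_hasDerivAt (fun y _ => h y)
    ((hg.comp (AddCircle.continuous_mk' _)).intervalIntegrable _ _)]
  have : ((2 * Real.pi : ℝ) : S1) = ((0 : ℝ) : S1) := by simp
  rw [this, sub_self]

theorem continuous_of_hasDerivAt {E : Type*} [NormedAddCommGroup E] [NormedSpace ℝ E]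
    {f g : S1 → E} (h : ∀ y : ℝ, HasDerivAt (fun z : ℝ => f (z : S1)) (g (y : S1)) y) :
    Continuous f :=
  continuous_coinduced_dom.mpr (continuous_iff_continuousAt.mpr fun y => (h y).continuousAt)

theorem integrable_S1 {E : Type*} [NormedAddCommGroup E] {f : S1 → E}
    (hf : Continuous f) {μ : Measure S1} [IsFiniteMeasure μ] : Integrable f μ :=
  hf.integrable_of_hasCompactSupport (HasCompactSupport.of_compactSpace f)

theorem integral_mul_derivative {A : Type*} [NormedRing A] [NormedAlgebra ℝ A] [CompleteSpace A]
    {f f' g g' : S1 → A} (hf' : Continuous f') (hg' : Continuous g')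
    (hf : ∀ y : ℝ, HasDerivAt (fun z : ℝ => f (z : S1)) (f' (y : S1)) y)
    (hg : ∀ y : ℝ, HasDerivAt (fun z : ℝ => g (z : S1)) (g' (y : S1)) y) :
    ∫ x, f' x * g x = -∫ x, f x * g' x := by
  have hfc := continuous_of_hasDerivAt hf
  have hgc := continuous_of_hasDerivAt hg
  have h := integral_derivative_eq_zero (f := fun x => f x * g x)
    (g := fun x => f' x * g x + f x * g' x) (by fun_prop) fun y => (hf y).mul (hg y)
  rw [integral_add (integrable_S1 (by fun_prop)) (integrable_S1 (by fun_prop))] at h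
  exact eq_neg_of_add_eq_zero_left h

theorem fourierCoeff_eq_integral (f : S1 → ℂ) (k : ℤ) :
    fourierCoeff f k = (2 * Real.pi : ℂ)⁻¹ * ∫ x, f x * fourier (-k) x := by
  rw [fourierCoeff, AddCircle.integral_haarAddCircle, Complex.real_smul]
  simp only [smul_eq_mul, mul_comm (fourier (-k) _)]
  push_cast
  rfl

theorem hasDerivAt_fourier_S1 (k : ℤ) (y : ℝ) :
    HasDerivAt (fun z : ℝ => (fourier k (z : S1) : ℂ)) (Complex.I * k * fourier k (y : S1)) y := by
  have h := hasDerivAt_fourier (2 * Real.pi) k y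
  have h2 : 2 * (Real.pi : ℂ) * Complex.I * k / ((2 * Real.pi : ℝ) : ℂ) = Complex.I * k := by
    have : (Real.pi : ℂ) ≠ 0 := by exact_mod_cast Real.pi_ne_zero
    push_cast; field_simp
  rwa [h2] at h

theorem fourierCoeff_derivative {f f' : S1 → ℂ} (hf' : Continuous f')
    (hf : ∀ y : ℝ, HasDerivAt (fun z : ℝ => f (z : S1)) (f' (y : S1)) y) (k : ℤ) :
    fourierCoeff f' k = Complex.I * k * fourierCoeff f k := by
  have h := integral_mul_derivative (g := fun x => fourier (-k) x)
    (g' := fun x => Complex.I * (-k : ℤ) * fourier (-k) x) hf' (by fun_prop) hf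
    (hasDerivAt_fourier_S1 (-k))
  rw [fourierCoeff_eq_integral, fourierCoeff_eq_integral, h]
  have h2 : (fun x => f x * (Complex.I * ((-k : ℤ) : ℂ) * fourier (-k) x))
      = fun x => (-(Complex.I * k)) * (f x * fourier (-k) x) := by
    funext x; push_cast; ring
  rw [h2, integral_const_mul]
  ring

theorem norm_fourier_apply (k : ℤ) (x : S1) : ‖(fourier k x : ℂ)‖ = 1 := by
  rw [fourier_apply]; exact Circle.norm_coe _

namespace Wiener

/-! ### Linear operations on the Wiener algebra -/

/-- `b` has the Fourier coefficients of the derivative of `a`. -/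
def IsDeriv (a b : Wiener) : Prop := ∀ k : ℤ, b k = Complex.I * k * a k

theorem IsDeriv.hasDerivAt {a b : Wiener} (h : IsDeriv a b) (y : ℝ) :
    HasDerivAt (fun z : ℝ => ev a (z : S1)) (ev b (y : S1)) y := by
  have h1 := hasDerivAt_tsum (u := fun k => ‖b k‖) (g := fun k (z : ℝ) => a k * fourier k (z : S1))
    (g' := fun k (z : ℝ) => b k * fourier k (z : S1)) (y₀ := 0) b.summable_norm
    (fun k z => ?_) (fun k z => ?_) (hasSum_ev a _).summable y
  · simpa only [(hasSum_ev _ _).tsum_eq] using h1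
  · rw [h k]
    exact ((hasDerivAt_fourier_S1 k z).const_mul (a k)).congr_deriv (by ring)
  · rw [norm_mul, norm_fourier_apply, mul_one]

theorem isDeriv_of_hasDerivAt {a b : Wiener}
    (h : ∀ y : ℝ, HasDerivAt (fun z : ℝ => ev a (z : S1)) (ev b (y : S1)) y) : IsDeriv a b :=
  fun k => by
    rw [← fourierCoeff_ev a, ← fourierCoeff_ev b]
    exact fourierCoeff_derivative (ev b).continuous h k

theorem IsDeriv.mul {a a' b b' : Wiener} (ha : IsDeriv a a') (hb : IsDeriv b b') :
    IsDeriv (a * b) (a' * b + a * b') :=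
  isDeriv_of_hasDerivAt fun y => by
    simpa using (ha.hasDerivAt y).fun_mul (hb.hasDerivAt y)

theorem IsDeriv.one_add {a a' : Wiener} (ha : IsDeriv a a') : IsDeriv (1 + a) a' :=
  isDeriv_of_hasDerivAt fun y => by
    simpa using (ha.hasDerivAt y).const_add 1

/-- The derivative of an inverse `r` of `a` is `-a' r²`. -/
theorem IsDeriv.inv {a a' r : Wiener} (ha : IsDeriv a a') (hr : a * r = 1) :
    IsDeriv r (-(a' * (r * r))) := by
  refine isDeriv_of_hasDerivAt fun y => ?_
  have he : ∀ x, ev a x * ev r x = 1 := fun x => by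
    rw [← ContinuousMap.mul_apply, ← ev_mul, hr]; simp
  have hne : ∀ x, ev a x ≠ 0 := fun x hx => by simpa [hx] using he x
  have hri : ∀ x, ev r x = (ev a x)⁻¹ := fun x => eq_inv_of_mul_eq_one_right (he x)
  have h := (ha.hasDerivAt y).fun_inv (hne _)
  simp_rw [hri]
  refine h.congr_deriv ?_
  rw [map_neg, ContinuousMap.neg_apply, ev_mul, ev_mul, ContinuousMap.mul_apply,
    ContinuousMap.mul_apply, hri]
  field_simp

theorem hasSum_norm_neg (a : Wiener) : HasSum (fun k => ‖a (-k)‖) ‖a‖ :=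
  (Equiv.neg ℤ).hasSum_iff.mpr a.hasSum_norm

@[simp] theorem real_smul_apply (c : ℝ) (a : Wiener) (k : ℤ) : (c • a) k = c * a k := rfl

/-- The Fourier multiplier with a bounded symbol. -/
def mult (m : ℤ → ℂ) (C : ℝ) (hm : ∀ k, ‖m k‖ ≤ C) : Wiener →L[ℝ] Wiener :=
  have hs (a : Wiener) : Summable fun k => ‖m k * a k‖ :=
    (a.summable_norm.mul_left C).of_nonneg_of_le (fun _ => norm_nonneg _) fun k => by
      rw [norm_mul]; exact mul_le_mul_of_nonneg_right (hm k) (norm_nonneg _)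
  LinearMap.mkContinuous
    { toFun := fun a => mk (fun k => m k * a k) (hs a)
      map_add' := fun a b => ext fun k => by simp [mul_add]
      map_smul' := fun c a => ext fun k => by simp; ring } C fun a => by
    refine hasSum_le (fun k => ?_) (hasSum_norm _) (a.hasSum_norm.mul_left C)
    simp only [LinearMap.coe_mk, AddHom.coe_mk, mk_apply, norm_mul]
    exact mul_le_mul_of_nonneg_right (hm k) (norm_nonneg _)

@[simp] theorem mult_apply (m : ℤ → ℂ) (C : ℝ) (hm : ∀ k, ‖m k‖ ≤ C) (a : Wiener) (k : ℤ) :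
    mult m C hm a k = m k * a k := rfl

theorem norm_mult_le (m : ℤ → ℂ) (C : ℝ) (hm : ∀ k, ‖m k‖ ≤ C) (a : Wiener) :
    ‖mult m C hm a‖ ≤ C * ‖a‖ := by
  refine hasSum_le (fun k => ?_) (hasSum_norm _) (a.hasSum_norm.mul_left C)
  rw [mult_apply, norm_mul]
  exact mul_le_mul_of_nonneg_right (hm k) (norm_nonneg _)

/-- Complex conjugation of functions, on the Fourier side. -/
def conjL : Wiener →L[ℝ] Wiener :=
  have hs (a : Wiener) : Summable fun k => ‖conj (a (-k))‖ := by
    simpa using a.hasSum_norm_neg.summable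
  LinearMap.mkContinuous
    { toFun := fun a => mk (fun k => conj (a (-k))) (hs a)
      map_add' := fun a b => ext fun k => by simp
      map_smul' := fun c a => ext fun k => by simp } 1 fun a => by
    refine hasSum_le (fun k => ?_) (hasSum_norm _) (a.hasSum_norm_neg.mul_left 1)
    simp

@[simp] theorem conjL_apply (a : Wiener) (k : ℤ) : conjL a k = conj (a (-k)) := rfl

theorem norm_conjL (a : Wiener) : ‖conjL a‖ = ‖a‖ := by
  refine (hasSum_norm _).unique ?_
  simpa using a.hasSum_norm_neg

theorem ev_conjL (a : Wiener) (x : S1) : ev (conjL a) x = conj (ev a x) := by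
  have h := (hasSum_ev a x).map (starRingEnd ℂ) Complex.continuous_conj
  have h2 := (Equiv.neg ℤ).hasSum_iff.mpr h
  refine (hasSum_ev _ x).unique ?_
  convert h2 using 1
  funext k
  simp only [conjL_apply, Function.comp_def, Equiv.neg_apply, map_mul]
  rw [← fourier_neg, neg_neg]

/-- The real part of a function, on the Fourier side. -/
def reL : Wiener →L[ℝ] Wiener := (1 / 2 : ℝ) • (ContinuousLinearMap.id ℝ Wiener + conjL)

/-- The imaginary part of a function, on the Fourier side. -/
def imL : Wiener →L[ℝ] Wiener := (-Complex.I / 2) • (ContinuousLinearMap.id ℝ Wiener - conjL)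

theorem reL_eq (a : Wiener) : reL a = (1 / 2 : ℝ) • (a + conjL a) := rfl

theorem imL_eq (a : Wiener) : imL a = (-Complex.I / 2) • (a - conjL a) := rfl

theorem norm_reL_le (a : Wiener) : ‖reL a‖ ≤ ‖a‖ := by
  rw [reL_eq, norm_smul]
  have := norm_add_le a (conjL a)
  rw [norm_conjL] at this
  norm_num
  linarith

theorem norm_imL_le (a : Wiener) : ‖imL a‖ ≤ ‖a‖ := by
  rw [imL_eq, norm_smul]
  have := norm_sub_le a (conjL a)
  rw [norm_conjL] at this
  norm_num
  linarith

theorem ev_imL (a : Wiener) (x : S1) : ev (imL a) x = ((ev a x).im : ℂ) := by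
  rw [imL_eq, map_smul, map_sub]
  simp only [ContinuousMap.smul_apply, ContinuousMap.sub_apply, ev_conjL, Complex.sub_conj,
    smul_eq_mul]
  push_cast
  linear_combination (-(ev a x).im : ℂ) * Complex.I_sq

theorem conjL_imL (a : Wiener) : conjL (imL a) = imL a :=
  ev_injective (ContinuousMap.ext fun x => by rw [ev_conjL, ev_imL, Complex.conj_ofReal])

theorem reL_of_conjL_eq {a : Wiener} (h : conjL a = a) : reL a = a :=
  ext fun k => by rw [reL_eq, h, real_smul_apply, add_apply]; push_cast; ring

/-- The elements with a single nonzero coefficient. -/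
def single (k : ℤ) : Wiener :=
  mk (fun j => if j = k then 1 else 0)
    (summable_of_ne_finset_zero (s := {k}) fun j hj => by simp_all)

theorem norm_single (k : ℤ) : ‖single k‖ = 1 := by
  rw [norm_eq, tsum_eq_single k fun j hj => by simp [single, hj]]
  simp [single]

theorem hasSum_single (a : Wiener) : HasSum (fun k => a k • single k) a := by
  have hs : Summable fun k => a k • single k :=
    Summable.of_norm (by simpa [norm_smul, norm_single] using a.summable_norm)
  have h : ∑' k, a k • single k = a := by
    refine ext fun j => ?_
    have h2 := (coeffL j).hasSum hs.hasSum
    refine h2.unique ?_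
    have : (fun k => coeffL j (a k • single k)) = fun k => if k = j then a j else 0 := by
      funext k
      simp only [coeffL_apply, smul_apply, single, mk_apply, eq_comm (a := j)]
      split_ifs with hk <;> simp [hk]
    rw [this]
    exact hasSum_ite_eq j (a j)
  convert hs.hasSum
  exact h.symm

/-- A Wiener-algebra valued function whose coefficients are measurable is measurable. -/
theorem aestronglyMeasurable_ofCoeff {Ω : Type*} [MeasurableSpace Ω] {μ : Measure Ω}
    {c : Ω → ℤ → ℂ} (hc : ∀ k, AEStronglyMeasurable (fun t => c t k) μ)
    (hs : ∀ᵐ t ∂μ, Summable fun k => ‖c t k‖) :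
    AEStronglyMeasurable (fun t => ofCoeff (c t)) μ := by
  refine aestronglyMeasurable_of_tendsto_ae (atTop : Filter (Finset ℤ))
    (f := fun s t => ∑ k ∈ s, c t k • single k) (fun s => ?_) ?_
  · exact Finset.aestronglyMeasurable_fun_sum s fun k _ => (hc k).smul_const _
  · filter_upwards [hs] with t ht
    have h := hasSum_single (ofCoeff (c t))
    simpa [ofCoeff_apply ht, HasSum] using h

/-! ### The nonlinearity -/

/-- Interpolation: `‖a'‖² ≤ ‖a‖ ‖a''‖`. -/
theorem IsDeriv.norm_sq_le {a b c : Wiener} (h : IsDeriv a b) (h' : IsDeriv b c) :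
    ‖b‖ ^ 2 ≤ ‖a‖ * ‖c‖ := by
  have key : ∀ t : ℝ, 0 ≤ ‖a‖ * (t * t) + (-(2 * ‖b‖)) * t + ‖c‖ := fun t => by
    have hs := ((a.hasSum_norm.mul_right (t * t)).add
      ((b.hasSum_norm.mul_left (2 : ℝ)).neg.mul_right t)).add c.hasSum_norm
    refine hs.nonneg fun k => ?_
    have h1 : ‖b k‖ = |(k : ℝ)| * ‖a k‖ := by rw [h k]; simp
    have h2 : ‖c k‖ = |(k : ℝ)| * (|(k : ℝ)| * ‖a k‖) := by rw [h' k, norm_mul, h1]; simp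
    rw [h1, h2]
    have : 0 ≤ ‖a k‖ * (t - |(k : ℝ)|) ^ 2 := by positivity
    linarith
  have := discrim_le_zero key
  rw [discrim] at this
  linarith

/-- The symbol `(1 - k) / (ik)` of the operator that maps `∂ₓw` to `w + i ∂ₓw`, for `w` of mean
zero. By convention it vanishes at `k = 0`. -/
def zSymbol (k : ℤ) : ℂ := (1 - k) / (Complex.I * k)

theorem norm_zSymbol (k : ℤ) : ‖zSymbol k‖ = |1 - (k : ℝ)| / |(k : ℝ)| := by
  have : (1 - k : ℂ) = ((1 - (k : ℝ) : ℝ) : ℂ) := by push_cast; rfl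
  rw [zSymbol, norm_div, norm_mul, Complex.norm_I, one_mul, this, Complex.norm_real]
  simp

/-- The identity `|1 - k| + |1 + k| = 2|k|` for `k ≠ 0`. -/
theorem norm_zSymbol_add_neg (k : ℤ) : ‖zSymbol k‖ + ‖zSymbol (-k)‖ ≤ 2 := by
  rw [norm_zSymbol, norm_zSymbol]
  rcases eq_or_ne k 0 with rfl | h0
  · simp
  push_cast
  rw [abs_neg, sub_neg_eq_add, ← add_div]
  refine div_le_of_le_mul₀ (abs_nonneg _) zero_le_two ?_
  rcases lt_trichotomy k 0 with h | h | h
  · have : (k : ℝ) ≤ -1 := by exact_mod_cast Int.le_sub_one_of_lt h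
    rw [abs_of_nonneg (by linarith : 0 ≤ 1 - (k : ℝ)),
      abs_of_nonpos (by linarith : 1 + (k : ℝ) ≤ 0),
      abs_of_neg (by linarith)]
    linarith
  · exact absurd h h0
  · have : (1 : ℝ) ≤ k := by exact_mod_cast h
    rw [abs_of_nonpos (by linarith : 1 - (k : ℝ) ≤ 0),
      abs_of_nonneg (by linarith : 0 ≤ 1 + (k : ℝ)),
      abs_of_pos (by linarith)]
    linarith

theorem norm_zSymbol_le (k : ℤ) : ‖zSymbol k‖ ≤ 2 :=
  (le_add_of_nonneg_right (norm_nonneg _)).trans (norm_zSymbol_add_neg k)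

/-- The real-linear operator that maps `p = ∂ₓw`, for `w` real and of mean zero, to `w + i ∂ₓw`.
Precomposing with the real part makes it nonexpansive on all of the Wiener algebra. -/
def zMap : Wiener →L[ℝ] Wiener := (mult zSymbol 2 norm_zSymbol_le).comp reL

theorem zMap_apply (a : Wiener) (k : ℤ) : zMap a k = zSymbol k * reL a k := rfl

/-- `zMap` is nonexpansive, although its symbol is only bounded by `2`: the coefficients of a real
function at `k` and `-k` have the same modulus. -/
theorem norm_zMap_le (a : Wiener) : ‖zMap a‖ ≤ ‖a‖ := by
  refine le_trans ?_ (norm_reL_le a)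
  set s := reL a with hs
  have hsym : ∀ k, ‖s (-k)‖ = ‖s k‖ := fun k => by
    rw [hs, reL_eq, real_smul_apply, real_smul_apply, norm_mul, norm_mul, add_apply, add_apply,
      conjL_apply, conjL_apply, neg_neg]
    congr 1
    rw [← Complex.norm_conj]
    simp [add_comm]
  have h := (zMap a).hasSum_norm.add (zMap a).hasSum_norm_neg
  have h2 := hasSum_le (fun k => ?_) h (s.hasSum_norm.mul_left (2 : ℝ))
  · linarith
  · rw [zMap_apply, zMap_apply, norm_mul, norm_mul, ← hs, hsym, ← add_mul]
    exact mul_le_mul_of_nonneg_right (norm_zSymbol_add_neg k) (norm_nonneg _)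

/-- The projection onto the functions of mean zero. -/
def meanFree : Wiener →L[ℝ] Wiener :=
  mult (fun k => if k = 0 then 0 else 1) 1 fun k => by split_ifs <;> simp

theorem meanFree_apply (a : Wiener) (k : ℤ) : meanFree a k = if k = 0 then 0 else a k := by
  rw [meanFree, mult_apply]; split_ifs <;> simp

theorem norm_meanFree_le (a : Wiener) : ‖meanFree a‖ ≤ ‖a‖ :=
  (norm_mult_le _ 1 _ a).trans_eq (one_mul _)

/-! #### Inverses near `1` -/

/-- The inverse `(1 + z)⁻¹` in the Wiener algebra. -/
def invOneAdd (z : Wiener) : Wiener := Ring.inverse (1 + z)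

theorem isUnit_one_add {z : Wiener} (hz : ‖z‖ < 1) : IsUnit (1 + z) := by
  have := isUnit_one_sub_of_norm_lt_one (x := -z) (by rwa [norm_neg])
  rwa [sub_neg_eq_add] at this

theorem one_add_mul_invOneAdd {z : Wiener} (hz : ‖z‖ < 1) : (1 + z) * invOneAdd z = 1 :=
  Ring.mul_inverse_cancel _ (isUnit_one_add hz)

theorem norm_invOneAdd_le {z : Wiener} (hz : ‖z‖ ≤ 1 / 8) : ‖invOneAdd z‖ ≤ 8 / 7 := by
  have h := one_add_mul_invOneAdd (hz.trans_lt (by norm_num))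
  have h1 : invOneAdd z = 1 - z * invOneAdd z := by rw [← h]; ring
  have h2 : ‖invOneAdd z‖ ≤ 1 + ‖z‖ * ‖invOneAdd z‖ := by
    conv_lhs => rw [h1]
    refine (norm_sub_le _ _).trans ?_
    rw [norm_one]
    exact add_le_add le_rfl (norm_mul_le _ _)
  have h3 := mul_le_mul_of_nonneg_right hz (norm_nonneg (invOneAdd z))
  linarith

theorem invOneAdd_sub_invOneAdd {z y : Wiener} (hz : ‖z‖ < 1) (hy : ‖y‖ < 1) :
    invOneAdd z - invOneAdd y = -((z - y) * (invOneAdd z * invOneAdd y)) := by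
  have h1 := one_add_mul_invOneAdd hz
  have h2 := one_add_mul_invOneAdd hy
  linear_combination (invOneAdd y) * h1 - (invOneAdd z) * h2

theorem norm_invOneAdd_sub_le {z y : Wiener} (hz : ‖z‖ ≤ 1 / 8) (hy : ‖y‖ ≤ 1 / 8) :
    ‖invOneAdd z - invOneAdd y‖ ≤ 64 / 49 * ‖z - y‖ := by
  rw [invOneAdd_sub_invOneAdd (hz.trans_lt (by norm_num)) (hy.trans_lt (by norm_num)), norm_neg]
  calc _ ≤ ‖z - y‖ * (‖invOneAdd z‖ * ‖invOneAdd y‖) :=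
        (norm_mul_le _ _).trans (by gcongr; exact norm_mul_le _ _)
    _ ≤ ‖z - y‖ * (8 / 7 * (8 / 7)) := by
        gcongr
        · exact norm_invOneAdd_le hz
        · exact norm_invOneAdd_le hy
    _ = _ := by ring

theorem hasSum_invOneAdd {z : Wiener} (hz : ‖z‖ < 1) :
    HasSum (fun n : ℕ => (-z) ^ n) (invOneAdd z) := by
  rw [← norm_neg] at hz
  have h := (summable_geometric_of_norm_lt_one hz).hasSum
  rwa [geom_series_eq_inverse _ hz, sub_neg_eq_add] at h

/-! #### Estimates of the nonlinearity -/

/-- With `r = (1 + z)⁻¹`, the expression `z z'' r + (z')² r²`; it equals `(z - log (1 + z))''`. -/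
def logNonlin (z zx zxx : Wiener) : Wiener :=
  z * zxx * invOneAdd z + zx * zx * (invOneAdd z * invOneAdd z)

theorem norm_logNonlin_le {z zx zxx : Wiener} {x D : ℝ} (hz : ‖z‖ ≤ x) (hx : x ≤ 1 / 8)
    (hzx : ‖zx‖ ^ 2 ≤ x * D) (hzxx : ‖zxx‖ ≤ D) :
    ‖logNonlin z zx zxx‖ ≤ 120 / 49 * (x * D) := by
  have hr := norm_invOneAdd_le (hz.trans hx)
  have hx0 := (norm_nonneg z).trans hz
  have hD0 := (norm_nonneg zxx).trans hzxx
  calc _ ≤ ‖z‖ * ‖zxx‖ * ‖invOneAdd z‖ + ‖zx‖ * ‖zx‖ * (‖invOneAdd z‖ * ‖invOneAdd z‖) := by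
        refine (norm_add_le _ _).trans (add_le_add ?_ ?_)
        · exact (norm_mul_le _ _).trans (by gcongr; exact norm_mul_le _ _)
        · exact (norm_mul_le _ _).trans (by gcongr <;> exact norm_mul_le _ _)
    _ ≤ x * D * (8 / 7) + x * D * (8 / 7 * (8 / 7)) := by
        rw [← pow_two]; gcongr
    _ = _ := by ring

theorem norm_logNonlin_sub_le {z zx zxx y yx yxx : Wiener} {e Dz Dy De : ℝ}
    (hz : ‖z‖ ≤ 1 / 8) (hy : ‖y‖ ≤ 1 / 8) (he : ‖z - y‖ ≤ e)
    (hzxx : ‖zxx‖ ≤ Dz) (hyxx : ‖yxx‖ ≤ Dy) (hexx : ‖zxx - yxx‖ ≤ De)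
    (hzx : ‖zx‖ ^ 2 ≤ 1 / 8 * Dz) (hyx : ‖yx‖ ^ 2 ≤ 1 / 8 * Dy) (hex : ‖zx - yx‖ ^ 2 ≤ e * De) :
    ‖logNonlin z zx zxx - logNonlin y yx yxx‖ ≤ 15 / 49 * De + 88 / 49 * (e * (Dz + Dy)) := by
  have hr := norm_invOneAdd_le hz
  have hs := norm_invOneAdd_le hy
  have hrs := (norm_invOneAdd_sub_le hz hy).trans (mul_le_mul_of_nonneg_left he (by norm_num))
  have he0 := (norm_nonneg _).trans he
  have hDz := (norm_nonneg _).trans hzxx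
  have hDy := (norm_nonneg _).trans hyxx
  have hDe := (norm_nonneg _).trans hexx
  set r := invOneAdd z
  set s := invOneAdd y
  -- `‖z' - y'‖ ‖z'‖` is controlled by Cauchy–Schwarz and interpolation
  have cs : ∀ {α β A B : ℝ}, 0 ≤ A → 0 ≤ B → α ^ 2 ≤ e * De → β ^ 2 ≤ 1 / 8 * A →
      α * β ≤ (e * A + 1 / 8 * De) / 2 := fun {α β A B} hA _ hα hβ => by
    have h1 : (α * β) ^ 2 ≤ ((e * A + 1 / 8 * De) / 2) ^ 2 := by
      have : (α * β) ^ 2 ≤ (e * De) * (1 / 8 * A) := by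
        rw [mul_pow]; gcongr
      nlinarith [sq_nonneg (e * A - 1 / 8 * De)]
    exact le_of_sq_le_sq h1 (by positivity)
  have e1 : logNonlin z zx zxx - logNonlin y yx yxx
      = (z - y) * zxx * r + y * (zxx - yxx) * r + y * yxx * (r - s)
        + (zx - yx) * zx * (r * r) + (zx - yx) * yx * (r * r) + yx * yx * ((r - s) * (r + s)) := by
    simp only [logNonlin]; ring
  have n3 : ∀ a b c : Wiener, ‖a * b * c‖ ≤ ‖a‖ * ‖b‖ * ‖c‖ := fun a b c =>
    (norm_mul_le _ _).trans (by gcongr; exact norm_mul_le _ _)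
  have hrr : ‖r * r‖ ≤ 64 / 49 := (norm_mul_le _ _).trans
    ((mul_le_mul hr hr (norm_nonneg _) (by norm_num)).trans_eq (by norm_num))
  have t1 : ‖(z - y) * zxx * r‖ ≤ e * Dz * (8 / 7) := (n3 _ _ _).trans (by gcongr)
  have t2 : ‖y * (zxx - yxx) * r‖ ≤ 1 / 8 * De * (8 / 7) := (n3 _ _ _).trans (by gcongr)
  have t3 : ‖y * yxx * (r - s)‖ ≤ 1 / 8 * Dy * (64 / 49 * e) := (n3 _ _ _).trans (by gcongr)
  have t4 : ‖(zx - yx) * zx * (r * r)‖ ≤ (e * Dz + 1 / 8 * De) / 2 * (64 / 49) :=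
    (n3 _ _ _).trans (by gcongr; exact cs hDz hDz hex hzx)
  have t5 : ‖(zx - yx) * yx * (r * r)‖ ≤ (e * Dy + 1 / 8 * De) / 2 * (64 / 49) :=
    (n3 _ _ _).trans (by gcongr; exact cs hDy hDy hex hyx)
  have t6 : ‖yx * yx * ((r - s) * (r + s))‖ ≤ 1 / 8 * Dy * (64 / 49 * e * (8 / 7 + 8 / 7)) := by
    refine (n3 _ _ _).trans ?_
    rw [← pow_two]
    have : ‖(r - s) * (r + s)‖ ≤ 64 / 49 * e * (8 / 7 + 8 / 7) :=
      (norm_mul_le _ _).trans (by gcongr; exact (norm_add_le _ _).trans (add_le_add hr hs))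
    gcongr
  rw [e1]
  have := norm_add_le_of_le (norm_add_le_of_le (norm_add_le_of_le (norm_add_le_of_le
    (norm_add_le_of_le t1 t2) t3) t4) t5) t6
  refine this.trans ?_
  have h1 : 0 ≤ e * Dy := by positivity
  linarith

/-- The nonlinear part of the equation `∂ₜp = ∂ₓ²p + nonlin p ∂ₓp ∂ₓ²p` for `p = ∂ₓw`. -/
def nonlin (p px pxx : Wiener) : Wiener :=
  -meanFree (imL (logNonlin (zMap p) (zMap px) (zMap pxx)))

theorem norm_nonlin_le {p px pxx : Wiener} (hp : ‖p‖ ≤ 1 / 8) (h1 : IsDeriv p px)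
    (h2 : IsDeriv px pxx) : ‖nonlin p px pxx‖ ≤ 120 / 49 * (‖p‖ * ‖pxx‖) := by
  rw [nonlin, norm_neg]
  refine (norm_meanFree_le _).trans ((norm_imL_le _).trans ?_)
  refine norm_logNonlin_le (norm_zMap_le p) hp ?_ (norm_zMap_le _)
  exact (pow_le_pow_left₀ (norm_nonneg _) (norm_zMap_le _) 2).trans (h1.norm_sq_le h2)

theorem norm_nonlin_sub_le {p px pxx q qx qxx : Wiener} (hp : ‖p‖ ≤ 1 / 8) (hq : ‖q‖ ≤ 1 / 8)
    (hp1 : IsDeriv p px) (hp2 : IsDeriv px pxx) (hq1 : IsDeriv q qx) (hq2 : IsDeriv qx qxx) :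
    ‖nonlin p px pxx - nonlin q qx qxx‖
      ≤ 15 / 49 * ‖pxx - qxx‖ + 88 / 49 * (‖p - q‖ * (‖pxx‖ + ‖qxx‖)) := by
  have hd : ∀ {a b c d : Wiener}, IsDeriv a b → IsDeriv c d → IsDeriv (a - c) (b - d) :=
    fun h h' k => by rw [sub_apply, sub_apply, h k, h' k]; ring
  have hsq : ∀ {a b c : Wiener}, IsDeriv a b → IsDeriv b c → ‖zMap b‖ ^ 2 ≤ ‖a‖ * ‖c‖ :=
    fun h h' => (pow_le_pow_left₀ (norm_nonneg _) (norm_zMap_le _) 2).trans (h.norm_sq_le h')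
  rw [nonlin, nonlin, ← neg_sub', norm_neg, ← map_sub, ← map_sub]
  refine (norm_meanFree_le _).trans ((norm_imL_le _).trans ?_)
  refine norm_logNonlin_sub_le ((norm_zMap_le _).trans hp) ((norm_zMap_le _).trans hq) ?_
    (norm_zMap_le _) (norm_zMap_le _) ?_ ?_ ?_ ?_
  · rw [← map_sub]; exact norm_zMap_le _
  · rw [← map_sub]; exact norm_zMap_le _
  · exact (hsq hp1 hp2).trans (by gcongr)
  · exact (hsq hq1 hq2).trans (by gcongr)
  · rw [← map_sub]; exact hsq (hd hp1 hq1) (hd hp2 hq2)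

theorem conjL_nonlin (p px pxx : Wiener) : conjL (nonlin p px pxx) = nonlin p px pxx := by
  refine ext fun k => ?_
  have h := conjL_imL (logNonlin (zMap p) (zMap px) (zMap pxx))
  have hk : ∀ k, conj (imL (logNonlin (zMap p) (zMap px) (zMap pxx)) (-k)) = _ :=
    fun k => DFunLike.congr_fun h k
  rw [nonlin, conjL_apply, neg_apply, neg_apply, meanFree_apply, meanFree_apply, map_neg,
    apply_ite conj, hk]
  simp

theorem aestronglyMeasurable_nonlin {Ω : Type*} [MeasurableSpace Ω] {μ : Measure Ω}
    {p px pxx : Ω → Wiener} (hp : AEStronglyMeasurable p μ) (hpx : AEStronglyMeasurable px μ)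
    (hpxx : AEStronglyMeasurable pxx μ) (hb : ∀ᵐ t ∂μ, ‖p t‖ < 1) :
    AEStronglyMeasurable (fun t => nonlin (p t) (px t) (pxx t)) μ := by
  have hz := zMap.continuous.comp_aestronglyMeasurable hp
  have hr : AEStronglyMeasurable (fun t => invOneAdd (zMap (p t))) μ := by
    refine aestronglyMeasurable_of_tendsto_ae atTop
      (f := fun N t => ∑ n ∈ Finset.range N, (-zMap (p t)) ^ n) (fun N => ?_) ?_
    · exact Finset.aestronglyMeasurable_fun_sum _ fun n _ => hz.neg.pow n
    · filter_upwards [hb] with t ht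
      exact (hasSum_invOneAdd ((norm_zMap_le _).trans_lt ht)).tendsto_sum_nat
  have hzx := zMap.continuous.comp_aestronglyMeasurable hpx
  have hzxx := zMap.continuous.comp_aestronglyMeasurable hpxx
  have h : AEStronglyMeasurable (fun t => logNonlin (zMap (p t)) (zMap (px t)) (zMap (pxx t))) μ :=
    ((hz.mul hzxx).mul hr).add ((hzx.mul hzx).mul (hr.mul hr))
  exact ((meanFree.comp imL).continuous.comp_aestronglyMeasurable h).neg

end Wiener

/-! ### Duhamel's formula for one Fourier mode -/

theorem intervalIntegrable_of_Ioc {E : Type*} [NormedAddCommGroup E] {g : ℝ → E} {t : ℝ}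
    (ht : 0 ≤ t) (hg : IntegrableOn g (Ioc 0 t)) : IntervalIntegrable g volume 0 t :=
  (intervalIntegrable_iff_integrableOn_Ioc_of_le ht).mpr hg

theorem continuousOn_primitive_Ici {E : Type*} [NormedAddCommGroup E] [NormedSpace ℝ E] {g : ℝ → E}
    (hg : ∀ t, 0 ≤ t → IntegrableOn g (Ioc 0 t)) :
    ContinuousOn (fun t => ∫ s in (0 : ℝ)..t, g s) (Ici 0) := by
  intro t ht
  have hT : 0 ≤ t + 1 := by linarith [mem_Ici.mp ht]
  have h1 := intervalIntegral.continuousOn_primitive_interval (a := 0) (b := t + 1) (μ := volume)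
    (f := g) (by rw [uIcc_of_le hT, integrableOn_Icc_iff_integrableOn_Ioc]; exact hg _ hT)
  rw [uIcc_of_le hT] at h1
  exact (h1 t ⟨ht, by linarith⟩).mono_of_mem_nhdsWithin (mem_nhdsWithin.mpr
    ⟨Iio (t + 1), isOpen_Iio, by simp, fun s hs => ⟨hs.2, (mem_Iio.mp hs.1).le⟩⟩)

section Duhamel

variable {E : Type*} [NormedAddCommGroup E] [NormedSpace ℝ E]

/-- Fubini on the triangle `0 < τ ≤ s ≤ t`. -/
theorem integral_smul_integral_swap [CompleteSpace E] {k : ℝ → ℝ} (hk : Continuous k) {f : ℝ → E}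
    {t : ℝ} (ht : 0 ≤ t) (hf : IntegrableOn f (Ioc 0 t)) :
    ∫ s in (0 : ℝ)..t, k s • ∫ τ in (0 : ℝ)..s, f τ
      = ∫ τ in (0 : ℝ)..t, (∫ s in τ..t, k s) • f τ := by
  set μ : Measure ℝ := volume.restrict (Ioc 0 t)
  have hS : MeasurableSet {q : ℝ × ℝ | q.2 ≤ q.1} := measurableSet_le measurable_snd measurable_fst
  have hki : Integrable k μ := (hk.integrableOn_Icc).mono_set Ioc_subset_Icc_self
  have hint : Integrable (fun q : ℝ × ℝ => {q : ℝ × ℝ | q.2 ≤ q.1}.indicator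
      (fun q => k q.1 • f q.2) q) (μ.prod μ) := (hki.smul_prod hf).indicator hS
  have h := integral_integral_swap (f := fun s τ => {q : ℝ × ℝ | q.2 ≤ q.1}.indicator
      (fun q => k q.1 • f q.2) (s, τ)) hint
  rw [intervalIntegral.integral_of_le ht, intervalIntegral.integral_of_le ht]
  convert h using 1
  · refine setIntegral_congr_fun measurableSet_Ioc fun s hs => ?_
    have : (fun τ => {q : ℝ × ℝ | q.2 ≤ q.1}.indicator (fun q => k q.1 • f q.2) (s, τ))
        = (Iic s).indicator fun τ => k s • f τ := by
      funext τ; simp [indicator]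
    simp only [this]
    rw [setIntegral_indicator measurableSet_Iic, integral_smul,
      intervalIntegral.integral_of_le hs.1.le]
    congr 3
    ext τ; simp only [mem_Ioc, mem_inter_iff, mem_Iic]
    exact ⟨fun h => ⟨⟨h.1, h.2.trans hs.2⟩, h.2⟩, fun h => ⟨h.1.1, h.2⟩⟩
  · refine setIntegral_congr_fun measurableSet_Ioc fun τ hτ => ?_
    have : (fun s => {q : ℝ × ℝ | q.2 ≤ q.1}.indicator (fun q => k q.1 • f q.2) (s, τ))
        = (Ici τ).indicator fun s => k s • f τ := by
      funext s; simp [indicator]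
    simp only [this]
    rw [setIntegral_indicator measurableSet_Ici, integral_smul_const,
      intervalIntegral.integral_of_le hτ.2, ← integral_Icc_eq_integral_Ioc]
    congr 3
    ext s; simp only [mem_Ioc, mem_inter_iff, mem_Icc, mem_Ici]
    exact ⟨fun h => ⟨⟨hτ.1.trans_le h.1, h.2⟩, h.1⟩, fun h => ⟨h.2, h.1.2⟩⟩

/-- The solution `e^{-lt} c + ∫₀ᵗ e^{-l(t-s)} g(s) ds` of `f' = -l f + g`, `f(0) = c`. -/
def duhamel (l : ℝ) (c : E) (g : ℝ → E) (t : ℝ) : E :=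
  Real.exp (-(l * t)) • (c + ∫ s in (0 : ℝ)..t, Real.exp (l * s) • g s)

theorem integrableOn_exp_smul {g : ℝ → E} (l : ℝ) {t : ℝ} (hg : IntegrableOn g (Ioc 0 t)) :
    IntegrableOn (fun s => Real.exp (l * s) • g s) (Ioc 0 t) := by
  refine Integrable.bdd_smul hg (Real.exp (|l| * |t|))
    (by fun_prop : Continuous fun s => Real.exp (l * s)).aestronglyMeasurable ?_
  filter_upwards [ae_restrict_mem measurableSet_Ioc] with s hs
  rw [Real.norm_eq_abs, Real.abs_exp, Real.exp_le_exp]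
  refine (le_abs_self _).trans ?_
  rw [abs_mul]
  gcongr
  exact hs.1.le
  exact hs.2

theorem continuousOn_duhamel (l : ℝ) (c : E) {g : ℝ → E}
    (hg : ∀ t, 0 ≤ t → IntegrableOn g (Ioc 0 t)) : ContinuousOn (duhamel l c g) (Ici 0) := by
  have h := continuousOn_primitive_Ici fun t ht => integrableOn_exp_smul l (hg t ht)
  unfold duhamel
  exact ContinuousOn.smul (by fun_prop) (continuousOn_const.add h)

/-- The integrated form of `f' = -l f + g`, `f(0) = c`. -/
theorem duhamel_add_integral [CompleteSpace E] (l : ℝ) (c : E) {g : ℝ → E} {t : ℝ} (ht : 0 ≤ t)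
    (hg : IntegrableOn g (Ioc 0 t)) :
    duhamel l c g t + l • ∫ s in (0 : ℝ)..t, duhamel l c g s = c + ∫ s in (0 : ℝ)..t, g s := by
  have hge := integrableOn_exp_smul l hg
  have hgi := intervalIntegrable_of_Ioc ht hge
  have hK : ∀ τ, ∫ s in τ..t, l * Real.exp (-(l * s)) = Real.exp (-(l * τ)) - Real.exp (-(l * t)) :=
    fun τ => by
      rw [intervalIntegral.integral_eq_sub_of_hasDerivAt (f := fun s => -Real.exp (-(l * s)))]
      · ring
      · intro s _
        have := (((hasDerivAt_id s).const_mul l).neg.exp).neg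
        refine this.congr_deriv ?_
        simp; ring
      · exact (by fun_prop : Continuous fun s => l * Real.exp (-(l * s))).intervalIntegrable _ _
  have hsw := integral_smul_integral_swap (k := fun s => l * Real.exp (-(l * s)))
    (by fun_prop) ht hge
  have hprim : ContinuousOn (fun s => ∫ τ in (0 : ℝ)..s, Real.exp (l * τ) • g τ) (uIcc 0 t) :=
    intervalIntegral.continuousOn_primitive_interval (by
      rwa [uIcc_of_le ht, integrableOn_Icc_iff_integrableOn_Ioc])
  have h1 : l • ∫ s in (0 : ℝ)..t, duhamel l c g s
      = (∫ s in (0 : ℝ)..t, l * Real.exp (-(l * s))) • c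
        + ∫ s in (0 : ℝ)..t, (l * Real.exp (-(l * s))) •
            ∫ τ in (0 : ℝ)..s, Real.exp (l * τ) • g τ := by
    rw [← intervalIntegral.integral_smul_const, ← intervalIntegral.integral_smul,
      ← intervalIntegral.integral_add]
    · refine intervalIntegral.integral_congr fun s _ => ?_
      simp only [duhamel, smul_add, mul_smul]
    · exact (by fun_prop : Continuous fun s => (l * Real.exp (-(l * s))) • c).intervalIntegrable _ _
    · exact (ContinuousOn.smul (by fun_prop) hprim).intervalIntegrable
  have h2 : ∫ τ in (0 : ℝ)..t, (∫ s in τ..t, l * Real.exp (-(l * s))) • Real.exp (l * τ) • g τ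
      = (∫ τ in (0 : ℝ)..t, g τ) - Real.exp (-(l * t)) •
          ∫ τ in (0 : ℝ)..t, Real.exp (l * τ) • g τ := by
    rw [← intervalIntegral.integral_smul, ← intervalIntegral.integral_sub]
    · refine intervalIntegral.integral_congr fun τ _ => ?_
      simp only [hK, sub_smul]
      congr 1
      rw [smul_smul, ← Real.exp_add, neg_add_cancel, Real.exp_zero, one_smul]
    · exact intervalIntegrable_of_Ioc ht hg
    · exact hgi.smul _
  rw [h1, hsw, h2, hK, duhamel]
  simp only [mul_zero, neg_zero, Real.exp_zero, smul_add, sub_smul, one_smul]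
  abel

theorem norm_duhamel_le (l : ℝ) (c : E) (g : ℝ → E) {t : ℝ} (ht : 0 ≤ t) :
    ‖duhamel l c g t‖ ≤ duhamel l ‖c‖ (fun s => ‖g s‖) t := by
  rw [duhamel, duhamel, norm_smul, Real.norm_eq_abs, Real.abs_exp, smul_eq_mul]
  gcongr
  refine (norm_add_le _ _).trans (add_le_add le_rfl ?_)
  refine (intervalIntegral.norm_integral_le_integral_norm ht).trans_eq ?_
  refine intervalIntegral.integral_congr fun s _ => ?_
  simp [norm_smul]

/-- The parabolic gain of one mode: its supremum and its time integral are controlled by the same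
amount of data. -/
theorem enorm_duhamel_add_lintegral_le {l : ℝ} (hl : 0 ≤ l) (c : E) {g : ℝ → E}
    (hg : ∀ t, 0 ≤ t → IntegrableOn g (Ioc 0 t)) {t : ℝ} (ht : 0 ≤ t) :
    ‖duhamel l c g t‖ₑ + ∫⁻ s in Ioc 0 t, ENNReal.ofReal l * ‖duhamel l c g s‖ₑ
      ≤ ‖c‖ₑ + ∫⁻ s in Ioc 0 t, ‖g s‖ₑ := by
  set m := duhamel l ‖c‖ (fun s => ‖g s‖)
  have hid := duhamel_add_integral l ‖c‖ ht (hg t ht).norm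
  have hle : ∀ s, 0 ≤ s → ‖duhamel l c g s‖ ≤ m s := fun s hs => norm_duhamel_le l c g hs
  have hm0 : ∀ s, 0 ≤ s → 0 ≤ m s := fun s hs => (norm_nonneg _).trans (hle s hs)
  have hmi : IntegrableOn m (Ioc 0 t) :=
    ((continuousOn_duhamel l ‖c‖ fun t ht => (hg t ht).norm).mono
      Icc_subset_Ici_self).integrableOn_Icc.mono_set Ioc_subset_Icc_self
  have h1 : ∫⁻ s in Ioc 0 t, ENNReal.ofReal l * ‖duhamel l c g s‖ₑ
      ≤ ENNReal.ofReal (l * ∫ s in (0 : ℝ)..t, m s) := by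
    rw [ENNReal.ofReal_mul hl, intervalIntegral.integral_of_le ht,
      ofReal_integral_eq_lintegral_ofReal hmi
        ((ae_restrict_mem measurableSet_Ioc).mono fun s hs => hm0 s hs.1.le),
      ← lintegral_const_mul' _ _ ENNReal.ofReal_ne_top]
    refine setLIntegral_mono' measurableSet_Ioc fun s hs => ?_
    gcongr
    rw [← ofReal_norm]
    exact ENNReal.ofReal_le_ofReal (hle s hs.1.le)
  have h2 : ∫⁻ s in Ioc 0 t, ‖g s‖ₑ = ENNReal.ofReal (∫ s in (0 : ℝ)..t, ‖g s‖) := by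
    rw [intervalIntegral.integral_of_le ht, ofReal_integral_norm_eq_lintegral_enorm (hg t ht)]
  have hi0 : 0 ≤ ∫ s in (0 : ℝ)..t, ‖g s‖ :=
    intervalIntegral.integral_nonneg ht fun _ _ => norm_nonneg _
  have hm1 : 0 ≤ l * ∫ s in (0 : ℝ)..t, m s :=
    mul_nonneg hl (intervalIntegral.integral_nonneg ht fun s hs => hm0 s hs.1)
  rw [h2, ← ofReal_norm c, ← ENNReal.ofReal_add (norm_nonneg _) hi0, ← hid, smul_eq_mul,
    ENNReal.ofReal_add (hm0 t ht) hm1]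
  gcongr
  rw [← ofReal_norm]
  exact ENNReal.ofReal_le_ofReal (hle t ht)

theorem duhamel_sub (l : ℝ) (c d : E) {g h : ℝ → E} {t : ℝ} (ht : 0 ≤ t)
    (hg : IntegrableOn g (Ioc 0 t)) (hh : IntegrableOn h (Ioc 0 t)) :
    duhamel l c g t - duhamel l d h t = duhamel l (c - d) (fun s => g s - h s) t := by
  simp only [duhamel, smul_sub]
  rw [intervalIntegral.integral_sub
    (intervalIntegrable_of_Ioc ht (integrableOn_exp_smul l hg))
    (intervalIntegrable_of_Ioc ht (integrableOn_exp_smul l hh)), ← smul_sub]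
  congr 1
  abel

end Duhamel

/-! ### The heat equation in the Wiener algebra -/

/-- The `k`-th Fourier mode of the solution of `∂ₜp = ∂ₓ²p + G`, `p(0) = p₀`. -/
def mode (p₀ : Wiener) (G : ℝ → Wiener) (k : ℤ) (t : ℝ) : ℂ :=
  duhamel ((k : ℝ) ^ 2) (p₀ k) (fun s => G s k) t

/-- The solution of `∂ₜp = ∂ₓ²p + G`, `p(0) = p₀`. -/
def heat (p₀ : Wiener) (G : ℝ → Wiener) (t : ℝ) : Wiener := .ofCoeff fun k => mode p₀ G k t

/-- The first space derivative of `heat p₀ G`. -/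
def heatX (p₀ : Wiener) (G : ℝ → Wiener) (t : ℝ) : Wiener :=
  .ofCoeff fun k => Complex.I * k * mode p₀ G k t

/-- The second space derivative of `heat p₀ G`. -/
def heatXX (p₀ : Wiener) (G : ℝ → Wiener) (t : ℝ) : Wiener :=
  .ofCoeff fun k => Complex.I * k * (Complex.I * k * mode p₀ G k t)

/-- Time is measured by Lebesgue measure on `(0, ∞)`. -/
abbrev timeMeasure : Measure ℝ := volume.restrict (Ioi 0)

section Heat

variable {p₀ : Wiener} {G : ℝ → Wiener}

theorem integrableOn_coeff (hG : Integrable G timeMeasure) (k : ℤ) (t : ℝ) :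
    IntegrableOn (fun s => G s k) (Ioc 0 t) :=
  ((Wiener.coeffL k).integrable_comp hG).mono_measure
    (Measure.restrict_mono Ioc_subset_Ioi_self le_rfl)

theorem continuousOn_mode (hG : Integrable G timeMeasure) (k : ℤ) :
    ContinuousOn (mode p₀ G k) (Ici 0) :=
  continuousOn_duhamel _ _ fun t _ => integrableOn_coeff hG k t

theorem aestronglyMeasurable_mode (hG : Integrable G timeMeasure) (k : ℤ) :
    AEStronglyMeasurable (mode p₀ G k) timeMeasure :=
  ((continuousOn_mode hG k).mono Ioi_subset_Ici_self).aestronglyMeasurable measurableSet_Ioi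

theorem norm_symbol_sq (k : ℤ) (z : ℂ) :
    ‖Complex.I * k * (Complex.I * k * z)‖ = (k : ℝ) ^ 2 * ‖z‖ := by
  simp only [norm_mul, Complex.norm_I, one_mul, Complex.norm_intCast]
  rw [← mul_assoc, ← pow_two, sq_abs]

/-- The parabolic gain in the Wiener algebra, as an inequality between sums over the modes. -/
theorem tsum_mode_add_lintegral_le (hG : Integrable G timeMeasure) {t : ℝ} (ht : 0 ≤ t) :
    (∑' k, ‖mode p₀ G k t‖ₑ)
        + ∫⁻ s in Ioc 0 t, ∑' k : ℤ, ‖Complex.I * k * (Complex.I * k * mode p₀ G k s)‖ₑ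
      ≤ ‖p₀‖ₑ + ∫⁻ s in Ioc 0 t, ‖G s‖ₑ := by
  have hsub : volume.restrict (Ioc 0 t) ≤ timeMeasure :=
    Measure.restrict_mono Ioc_subset_Ioi_self le_rfl
  have h0 : ∀ k s, ‖Complex.I * k * (Complex.I * k * mode p₀ G k s)‖ₑ
      = ENNReal.ofReal ((k : ℝ) ^ 2) * ‖mode p₀ G k s‖ₑ := fun k s => by
    rw [← ofReal_norm, norm_symbol_sq, ENNReal.ofReal_mul (sq_nonneg _), ofReal_norm]
  simp only [h0, Wiener.enorm_eq]
  rw [lintegral_tsum fun k =>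
      (((aestronglyMeasurable_mode hG k).enorm).mono_measure hsub).const_mul _,
    lintegral_tsum fun k => ((integrableOn_coeff hG k t).aestronglyMeasurable).enorm,
    ← ENNReal.tsum_add, ← ENNReal.tsum_add]
  exact ENNReal.tsum_le_tsum fun k =>
    enorm_duhamel_add_lintegral_le (sq_nonneg _) _ (fun t _ => integrableOn_coeff hG k t) ht

theorem summable_of_tsum_enorm_ne_top {c : ℤ → ℂ} (h : ∑' k, ‖c k‖ₑ ≠ ∞) :
    Summable fun k => ‖c k‖ := by
  have := ENNReal.summable_toReal h
  simpa using this

theorem data_lt_top (hG : Integrable G timeMeasure) (t : ℝ) :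
    ‖p₀‖ₑ + ∫⁻ s in Ioc 0 t, ‖G s‖ₑ < ∞ :=
  ENNReal.add_lt_top.mpr ⟨enorm_lt_top, (lintegral_mono' (Measure.restrict_mono
    Ioc_subset_Ioi_self le_rfl) le_rfl).trans_lt hG.hasFiniteIntegral⟩

theorem summable_mode (hG : Integrable G timeMeasure) {t : ℝ} (ht : 0 ≤ t) :
    Summable fun k => ‖mode p₀ G k t‖ :=
  summable_of_tsum_enorm_ne_top
    ((le_self_add.trans (tsum_mode_add_lintegral_le hG ht)).trans_lt (data_lt_top hG t)).ne

theorem heat_apply (hG : Integrable G timeMeasure) {t : ℝ} (ht : 0 ≤ t) (k : ℤ) :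
    heat p₀ G t k = mode p₀ G k t := Wiener.ofCoeff_apply (summable_mode hG ht) k

theorem ae_timeMeasure_of_Ioc {P : ℝ → Prop}
    (h : ∀ t, 0 ≤ t → ∀ᵐ s ∂volume.restrict (Ioc 0 t), P s) : ∀ᵐ s ∂timeMeasure, P s := by
  have hU : Ioi (0 : ℝ) = ⋃ n : ℕ, Ioc (0 : ℝ) n := by
    ext s
    simp only [mem_Ioi, mem_iUnion, mem_Ioc]
    exact ⟨fun hs => (exists_nat_ge s).imp fun n hn => ⟨hs, hn⟩, fun ⟨_, hn⟩ => hn.1⟩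
  rw [timeMeasure, hU, ae_restrict_iUnion_iff]
  exact fun n => h n n.cast_nonneg

theorem lintegral_timeMeasure_le_of_Ioc {f : ℝ → ℝ≥0∞} {C : ℝ≥0∞}
    (h : ∀ t, 0 ≤ t → ∫⁻ s in Ioc 0 t, f s ≤ C) : ∫⁻ s, f s ∂timeMeasure ≤ C := by
  have hU : Ioi (0 : ℝ) = ⋃ n : ℕ, Ioc (0 : ℝ) n := by
    ext s
    simp only [mem_Ioi, mem_iUnion, mem_Ioc]
    exact ⟨fun hs => (exists_nat_ge s).imp fun n hn => ⟨hs, hn⟩, fun ⟨_, hn⟩ => hn.1⟩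
  rw [timeMeasure, hU, setLIntegral_iUnion_of_directed]
  · exact iSup_le fun n => h n n.cast_nonneg
  · exact Monotone.directed_le fun m n hmn => Ioc_subset_Ioc_right (by exact_mod_cast hmn)

theorem ae_summable_modeXX (hG : Integrable G timeMeasure) :
    ∀ᵐ t ∂timeMeasure, Summable fun k : ℤ => ‖Complex.I * k * (Complex.I * k * mode p₀ G k t)‖ := by
  refine ae_timeMeasure_of_Ioc fun t ht => ?_
  have h := ((le_add_self.trans (tsum_mode_add_lintegral_le hG ht)).trans_lt
    (data_lt_top (p₀ := p₀) hG t)).ne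
  have hm : AEMeasurable (fun s => ∑' k : ℤ, ‖Complex.I * k * (Complex.I * k * mode p₀ G k s)‖ₑ)
      (volume.restrict (Ioc 0 t)) := AEMeasurable.tsum fun k =>
    ((((aestronglyMeasurable_mode hG k).mono_measure
      (Measure.restrict_mono Ioc_subset_Ioi_self le_rfl)).const_mul _).const_mul _).enorm
  exact (ae_lt_top' hm h).mono fun s hs => summable_of_tsum_enorm_ne_top hs.ne

theorem ae_summable_modeX (hG : Integrable G timeMeasure) :
    ∀ᵐ t ∂timeMeasure, Summable fun k : ℤ => ‖Complex.I * k * mode p₀ G k t‖ := by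
  filter_upwards [ae_summable_modeXX (p₀ := p₀) hG] with t ht
  refine ht.of_nonneg_of_le (fun _ => norm_nonneg _) fun k => ?_
  rw [norm_mul (Complex.I * k) (Complex.I * k * _)]
  rcases eq_or_ne k 0 with rfl | hk
  · simp
  refine le_mul_of_one_le_left (norm_nonneg _) ?_
  simp only [norm_mul, Complex.norm_I, one_mul, Complex.norm_intCast]
  exact_mod_cast Int.one_le_abs hk

theorem aestronglyMeasurable_heat (hG : Integrable G timeMeasure) :
    AEStronglyMeasurable (heat p₀ G) timeMeasure :=
  Wiener.aestronglyMeasurable_ofCoeff (aestronglyMeasurable_mode hG)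
    ((ae_restrict_mem measurableSet_Ioi).mono fun _ ht => summable_mode hG (mem_Ioi.mp ht).le)

theorem aestronglyMeasurable_heatX (hG : Integrable G timeMeasure) :
    AEStronglyMeasurable (heatX p₀ G) timeMeasure :=
  Wiener.aestronglyMeasurable_ofCoeff (fun k => (aestronglyMeasurable_mode hG k).const_mul _)
    (ae_summable_modeX hG)

theorem aestronglyMeasurable_heatXX (hG : Integrable G timeMeasure) :
    AEStronglyMeasurable (heatXX p₀ G) timeMeasure :=
  Wiener.aestronglyMeasurable_ofCoeff
    (fun k => ((aestronglyMeasurable_mode hG k).const_mul _).const_mul _) (ae_summable_modeXX hG)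

theorem ae_isDeriv_heat (hG : Integrable G timeMeasure) : ∀ᵐ t ∂timeMeasure,
    Wiener.IsDeriv (heat p₀ G t) (heatX p₀ G t) ∧
      Wiener.IsDeriv (heatX p₀ G t) (heatXX p₀ G t) := by
  filter_upwards [ae_summable_modeXX (p₀ := p₀) hG, ae_summable_modeX (p₀ := p₀) hG,
    ae_restrict_mem measurableSet_Ioi] with t h2 h1 ht
  constructor <;> intro k
  · rw [heatX, Wiener.ofCoeff_apply h1, heat_apply hG (mem_Ioi.mp ht).le]
  · rw [heatXX, Wiener.ofCoeff_apply h2, heatX, Wiener.ofCoeff_apply h1]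

/-- The parabolic gain in the Wiener algebra. -/
theorem enorm_heat_add_lintegral_le (hG : Integrable G timeMeasure) {t : ℝ} (ht : 0 ≤ t) :
    ‖heat p₀ G t‖ₑ + ∫⁻ s in Ioc 0 t, ‖heatXX p₀ G s‖ₑ ≤ ‖p₀‖ₑ + ∫⁻ s, ‖G s‖ₑ ∂timeMeasure := by
  refine le_trans ?_ ((tsum_mode_add_lintegral_le (p₀ := p₀) hG ht).trans ?_)
  · gcongr
    · exact Wiener.enorm_ofCoeff_le _
    · exact Wiener.enorm_ofCoeff_le _
  · exact add_le_add le_rfl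
      (lintegral_mono' (Measure.restrict_mono Ioc_subset_Ioi_self le_rfl) le_rfl)

theorem lintegral_heatXX_le (hG : Integrable G timeMeasure) :
    ∫⁻ s, ‖heatXX p₀ G s‖ₑ ∂timeMeasure ≤ ‖p₀‖ₑ + ∫⁻ s, ‖G s‖ₑ ∂timeMeasure :=
  lintegral_timeMeasure_le_of_Ioc fun _ ht =>
    le_add_self.trans (enorm_heat_add_lintegral_le hG ht)

theorem enorm_heat_le (hG : Integrable G timeMeasure) {t : ℝ} (ht : 0 ≤ t) :
    ‖heat p₀ G t‖ₑ ≤ ‖p₀‖ₑ + ∫⁻ s, ‖G s‖ₑ ∂timeMeasure :=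
  le_self_add.trans (enorm_heat_add_lintegral_le hG ht)

theorem integrable_heatXX (hG : Integrable G timeMeasure) :
    Integrable (heatXX p₀ G) timeMeasure :=
  ⟨aestronglyMeasurable_heatXX hG, (lintegral_heatXX_le hG).trans_lt
    (ENNReal.add_lt_top.mpr ⟨enorm_lt_top, hG.hasFiniteIntegral⟩)⟩

/-- The integrated form of `∂ₜp = ∂ₓ²p + G`. -/
theorem heat_eq_add_integral (hG : Integrable G timeMeasure) {t : ℝ} (ht : 0 ≤ t) :
    heat p₀ G t = p₀ + ∫ s in (0 : ℝ)..t, (heatXX p₀ G s + G s) := by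
  have hsub : volume.restrict (Ioc 0 t) ≤ timeMeasure :=
    Measure.restrict_mono Ioc_subset_Ioi_self le_rfl
  have hi : IntervalIntegrable (fun s => heatXX p₀ G s + G s) volume 0 t :=
    intervalIntegrable_of_Ioc ht (((integrable_heatXX hG).add hG).mono_measure hsub)
  refine Wiener.ext fun k => ?_
  have h1 := (Wiener.coeffL k).intervalIntegral_comp_comm hi
  simp only [Wiener.coeffL_apply] at h1
  rw [heat_apply hG ht, Wiener.add_apply, ← h1]
  have h2 := duhamel_add_integral ((k : ℝ) ^ 2) (p₀ k) ht (integrableOn_coeff hG k t)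
  change mode p₀ G k t + _ • ∫ s in (0 : ℝ)..t, mode p₀ G k s = _ at h2
  have hc : ContinuousOn (mode p₀ G k) (uIcc 0 t) :=
    (continuousOn_mode hG k).mono (by rw [uIcc_of_le ht]; exact Icc_subset_Ici_self)
  have h3 : ∫ s in (0 : ℝ)..t, (heatXX p₀ G s + G s) k
      = (∫ s in (0 : ℝ)..t, (-(k : ℝ) ^ 2) • mode p₀ G k s) + ∫ s in (0 : ℝ)..t, G s k := by
    rw [← intervalIntegral.integral_add (f := fun s => (-(k : ℝ) ^ 2) • mode p₀ G k s)
      (g := fun s => G s k) (hc.fun_const_smul _).intervalIntegrable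
      (intervalIntegrable_of_Ioc ht (integrableOn_coeff hG k t))]
    refine intervalIntegral.integral_congr_ae ?_
    rw [uIoc_of_le ht, ← ae_restrict_iff' measurableSet_Ioc]
    refine ae_mono hsub ?_
    filter_upwards [ae_summable_modeXX (p₀ := p₀) hG] with s hs
    rw [Wiener.add_apply, heatXX, Wiener.ofCoeff_apply hs, Complex.real_smul]
    congr 1
    push_cast
    linear_combination (k : ℂ) ^ 2 * mode p₀ G k s * Complex.I_sq
  rw [h3, intervalIntegral.integral_smul, neg_smul, neg_add_eq_sub, ← add_sub_assoc, ← h2,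
    add_sub_cancel_right]

theorem continuousOn_heat (hG : Integrable G timeMeasure) : ContinuousOn (heat p₀ G) (Ici 0) := by
  have h : ContinuousOn (fun t => p₀ + ∫ s in (0 : ℝ)..t, (heatXX p₀ G s + G s)) (Ici 0) :=
    continuousOn_const.add (continuousOn_primitive_Ici fun t _ =>
      ((integrable_heatXX hG).add hG).mono_measure
        (Measure.restrict_mono Ioc_subset_Ioi_self le_rfl))
  exact h.congr fun t ht => heat_eq_add_integral hG ht

theorem heat_zero (hG : Integrable G timeMeasure) : heat p₀ G 0 = p₀ := by
  rw [heat_eq_add_integral hG le_rfl]; simp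

/-- Solutions depend linearly on the data. -/
theorem heat_sub (p₀ : Wiener) {G H : ℝ → Wiener} (hG : Integrable G timeMeasure)
    (hH : Integrable H timeMeasure) {t : ℝ} (ht : 0 ≤ t) :
    heat p₀ G t - heat p₀ H t = heat 0 (fun s => G s - H s) t := by
  refine Wiener.ext fun k => ?_
  have hs : Integrable (fun s => G s - H s) timeMeasure := hG.sub hH
  rw [Wiener.sub_apply, heat_apply hG ht, heat_apply hH ht, heat_apply hs ht]
  have := duhamel_sub ((k : ℝ) ^ 2) (p₀ k) (p₀ k) ht (integrableOn_coeff hG k t)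
    (integrableOn_coeff hH k t)
  simpa [mode] using this

theorem ae_heatXX_sub (p₀ : Wiener) {G H : ℝ → Wiener} (hG : Integrable G timeMeasure)
    (hH : Integrable H timeMeasure) : ∀ᵐ t ∂timeMeasure,
    heatXX p₀ G t - heatXX p₀ H t = heatXX 0 (fun s => G s - H s) t := by
  filter_upwards [ae_isDeriv_heat (p₀ := p₀) hG, ae_isDeriv_heat (p₀ := p₀) hH,
    ae_isDeriv_heat (p₀ := 0) (hG.sub hH), ae_restrict_mem measurableSet_Ioi] with t h1 h2 h3 ht
  refine Wiener.ext fun k => ?_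
  have h3a := h3.1 k
  have h3b := h3.2 k
  simp only [Pi.sub_def] at h3a h3b
  rw [Wiener.sub_apply, h1.2 k, h2.2 k, h3b, h1.1 k, h2.1 k, h3a,
    ← heat_sub p₀ hG hH (mem_Ioi.mp ht).le, Wiener.sub_apply]
  ring

end Heat

/-! ### The fixed point -/

/-- If `X(t) + ∫₀ᵗ D ≤ r`, then `∫ X D ≤ r² / 2`. The factor `1/2`, which comes from the symmetry of
`∫∫ D(s) D(t) ds dt`, is what makes the smallness constant `1/10` admissible. -/
theorem two_mul_lintegral_mul_le {X D : ℝ → ℝ≥0∞} {r : ℝ≥0∞} (hr : r ≠ ∞)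
    (hD : AEMeasurable D timeMeasure) (hDr : ∫⁻ t, D t ∂timeMeasure ≤ r)
    (h : ∀ t, 0 < t → X t + ∫⁻ s in Ioc 0 t, D s ≤ r) :
    2 * ∫⁻ t, X t * D t ∂timeMeasure ≤ r ^ 2 := by
  set μ := timeMeasure
  set I := ∫⁻ t, D t ∂μ with hI
  have hS : MeasurableSet {q : ℝ × ℝ | q.2 ≤ q.1} := measurableSet_le measurable_snd measurable_fst
  set F : ℝ × ℝ → ℝ≥0∞ := {q : ℝ × ℝ | q.2 ≤ q.1}.indicator fun q => D q.1 * D q.2 with hF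
  have hFm : AEMeasurable F (μ.prod μ) := ((hD.comp_quasiMeasurePreserving
    Measure.quasiMeasurePreserving_fst).mul (hD.comp_quasiMeasurePreserving
    Measure.quasiMeasurePreserving_snd)).indicator hS
  have hsq : I ^ 2 ≤ 2 * ∫⁻ q, F q ∂μ.prod μ := by
    rw [pow_two, hI, ← lintegral_prod_mul hD hD, two_mul]
    conv_rhs => arg 2; rw [← lintegral_prod_swap]
    rw [← lintegral_add_left' hFm]
    refine lintegral_mono fun q => ?_
    rcases le_total q.2 q.1 with hq | hq
    · exact le_trans (by simp [hF, hq]) le_self_add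
    · exact le_trans (by simp [hF, hq, mul_comm]) le_add_self
  have hin : ∀ t ∈ Ioi (0 : ℝ), ∫⁻ s, F (t, s) ∂μ = D t * ∫⁻ s in Ioc 0 t, D s := fun t ht => by
    have : (fun s => F (t, s)) = (Iic t).indicator fun s => D t * D s := by
      funext s; simp [hF, indicator]
    rw [this, lintegral_indicator measurableSet_Iic, lintegral_const_mul'' _ hD.restrict,
      Measure.restrict_restrict measurableSet_Iic, Iic_inter_Ioi]
  have hmain : (∫⁻ t, X t * D t ∂μ) + ∫⁻ q, F q ∂μ.prod μ ≤ r * I := by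
    rw [lintegral_prod _ hFm, ← lintegral_add_right' _ hFm.lintegral_prod_right', hI,
      ← lintegral_const_mul'' _ hD]
    refine setLIntegral_mono_ae' measurableSet_Ioi (ae_of_all _ fun t ht => ?_)
    rw [hin t ht, mul_comm (X t), ← mul_add, mul_comm r]
    gcongr
    exact h t ht
  have hIt : I ≠ ∞ := (hDr.trans_lt hr.lt_top).ne
  have hXt : ∫⁻ t, X t * D t ∂μ ≠ ∞ :=
    ((le_self_add.trans hmain).trans_lt (ENNReal.mul_lt_top hr.lt_top hIt.lt_top)).ne
  have hAt : ∫⁻ q, F q ∂μ.prod μ ≠ ∞ :=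
    ((le_add_self.trans hmain).trans_lt (ENNReal.mul_lt_top hr.lt_top hIt.lt_top)).ne
  set x := ∫⁻ t, X t * D t ∂μ
  set A := ∫⁻ q, F q ∂μ.prod μ
  clear_value x A I
  lift x to NNReal using hXt
  lift A to NNReal using hAt
  lift I to NNReal using hIt
  lift r to NNReal using hr
  norm_cast at *
  have h1 : (I : ℝ) ^ 2 ≤ 2 * A := by exact_mod_cast hsq
  have h2 : (x : ℝ) + A ≤ r * I := by exact_mod_cast hmain
  have : (2 * x : ℝ) ≤ r ^ 2 := by nlinarith [sq_nonneg ((r : ℝ) - I)]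
  exact_mod_cast this

/-- The right-hand side `G` of the heat equation that corresponds to the solution `heat p₀ G`. -/
def source (p₀ : Wiener) (G : ℝ → Wiener) (t : ℝ) : Wiener :=
  .nonlin (heat p₀ G t) (heatX p₀ G t) (heatXX p₀ G t)

section FixedPoint

variable {p₀ : Wiener} {G H : ℝ → Wiener}

/-- The total amount of data that the fixed point argument allows is `1/8 = 1/10 + 1/40`. -/
theorem data_le (hp : ‖p₀‖ ≤ 1 / 10) (hG1 : ∫⁻ s, ‖G s‖ₑ ∂timeMeasure ≤ ENNReal.ofReal (1 / 40)) :
    ‖p₀‖ₑ + ∫⁻ s, ‖G s‖ₑ ∂timeMeasure ≤ ENNReal.ofReal (1 / 8) := by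
  have : (1 / 8 : ℝ) = 1 / 10 + 1 / 40 := by norm_num
  rw [this, ENNReal.ofReal_add (by norm_num) (by norm_num), ← ofReal_norm]
  gcongr

theorem norm_heat_le (hG : Integrable G timeMeasure) (hp : ‖p₀‖ ≤ 1 / 10)
    (hG1 : ∫⁻ s, ‖G s‖ₑ ∂timeMeasure ≤ ENNReal.ofReal (1 / 40)) {t : ℝ} (ht : 0 ≤ t) :
    ‖heat p₀ G t‖ ≤ 1 / 8 := by
  have h := (enorm_heat_le (p₀ := p₀) hG ht).trans (data_le hp hG1)
  rw [← ofReal_norm] at h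
  exact (ENNReal.ofReal_le_ofReal_iff (by norm_num)).mp h

theorem aestronglyMeasurable_source (hG : Integrable G timeMeasure) (hp : ‖p₀‖ ≤ 1 / 10)
    (hG1 : ∫⁻ s, ‖G s‖ₑ ∂timeMeasure ≤ ENNReal.ofReal (1 / 40)) :
    AEStronglyMeasurable (source p₀ G) timeMeasure :=
  Wiener.aestronglyMeasurable_nonlin (aestronglyMeasurable_heat hG) (aestronglyMeasurable_heatX hG)
    (aestronglyMeasurable_heatXX hG) ((ae_restrict_mem measurableSet_Ioi).mono fun _ ht =>
      (norm_heat_le hG hp hG1 (mem_Ioi.mp ht).le).trans_lt (by norm_num))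

/-- `source` maps the ball of radius `1/40` to itself: `120/49 * (1/8)² / 2 < 1/40`. -/
theorem lintegral_source_le (hG : Integrable G timeMeasure) (hp : ‖p₀‖ ≤ 1 / 10)
    (hG1 : ∫⁻ s, ‖G s‖ₑ ∂timeMeasure ≤ ENNReal.ofReal (1 / 40)) :
    ∫⁻ s, ‖source p₀ G s‖ₑ ∂timeMeasure ≤ ENNReal.ofReal (1 / 40) := by
  have hr := data_le hp hG1
  have h1 := two_mul_lintegral_mul_le (X := fun t => ‖heat p₀ G t‖ₑ)
    (D := fun t => ‖heatXX p₀ G t‖ₑ) (r := ENNReal.ofReal (1 / 8)) ENNReal.ofReal_ne_top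
    (aestronglyMeasurable_heatXX hG).enorm ((lintegral_heatXX_le hG).trans hr)
    fun t ht => (enorm_heat_add_lintegral_le hG ht.le).trans hr
  have h2 : ∫⁻ s, ‖source p₀ G s‖ₑ ∂timeMeasure
      ≤ ENNReal.ofReal (60 / 49) * (2 * ∫⁻ t, ‖heat p₀ G t‖ₑ * ‖heatXX p₀ G t‖ₑ ∂timeMeasure) := by
    rw [← mul_assoc, ← lintegral_const_mul' _ _ (by finiteness)]
    refine lintegral_mono_ae ?_
    filter_upwards [ae_isDeriv_heat (p₀ := p₀) hG, ae_restrict_mem measurableSet_Ioi] with t hd ht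
    have := Wiener.norm_nonlin_le (norm_heat_le hG hp hG1 (mem_Ioi.mp ht).le) hd.1 hd.2
    have h3 : ENNReal.ofReal (60 / 49) * 2 = ENNReal.ofReal (120 / 49) := by
      rw [← ENNReal.ofReal_ofNat 2, ← ENNReal.ofReal_mul (by norm_num)]; norm_num
    rw [h3, ← ofReal_norm, ← ofReal_norm, ← ofReal_norm, ← ENNReal.ofReal_mul (norm_nonneg _),
      ← ENNReal.ofReal_mul (by norm_num)]
    exact ENNReal.ofReal_le_ofReal this
  refine h2.trans ((mul_le_mul_right h1 _).trans ?_)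
  rw [← ENNReal.ofReal_pow (by norm_num), ← ENNReal.ofReal_mul (by norm_num)]
  exact ENNReal.ofReal_le_ofReal (by norm_num)

/-- `source` is a contraction, with constant `15/49 + 88/49 * (1/8 + 1/8) = 37/49`. -/
theorem lintegral_source_sub_le (hG : Integrable G timeMeasure) (hH : Integrable H timeMeasure)
    (hp : ‖p₀‖ ≤ 1 / 10) (hG1 : ∫⁻ s, ‖G s‖ₑ ∂timeMeasure ≤ ENNReal.ofReal (1 / 40))
    (hH1 : ∫⁻ s, ‖H s‖ₑ ∂timeMeasure ≤ ENNReal.ofReal (1 / 40)) :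
    ∫⁻ s, ‖source p₀ G s - source p₀ H s‖ₑ ∂timeMeasure
      ≤ ENNReal.ofReal (37 / 49) * ∫⁻ s, ‖G s - H s‖ₑ ∂timeMeasure := by
  set d := ∫⁻ s, ‖G s - H s‖ₑ ∂timeMeasure with hd
  have hs : Integrable (fun s => G s - H s) timeMeasure := hG.sub hH
  have hdata : ‖(0 : Wiener)‖ₑ + d = d := by simp
  have hDd := lintegral_heatXX_le (p₀ := 0) hs
  rw [← hd, hdata] at hDd
  have hDG := (lintegral_heatXX_le (p₀ := p₀) hG).trans (data_le hp hG1)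
  have hDH := (lintegral_heatXX_le (p₀ := p₀) hH).trans (data_le hp hH1)
  have hmd := (aestronglyMeasurable_heatXX (p₀ := 0) hs).enorm
  have hmG := (aestronglyMeasurable_heatXX (p₀ := p₀) hG).enorm
  have hmH := (aestronglyMeasurable_heatXX (p₀ := p₀) hH).enorm
  calc _ ≤ ∫⁻ t, (ENNReal.ofReal (15 / 49) * ‖heatXX 0 (fun s => G s - H s) t‖ₑ
        + ENNReal.ofReal (88 / 49) * d * (‖heatXX p₀ G t‖ₑ + ‖heatXX p₀ H t‖ₑ)) ∂timeMeasure := by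
        refine lintegral_mono_ae ?_
        filter_upwards [ae_isDeriv_heat (p₀ := p₀) hG, ae_isDeriv_heat (p₀ := p₀) hH,
          ae_heatXX_sub p₀ hG hH, ae_restrict_mem measurableSet_Ioi] with t h1 h2 h3 ht
        have ht0 := (mem_Ioi.mp ht).le
        have hX := enorm_heat_le (p₀ := 0) hs ht0
        rw [← hd, hdata, ← heat_sub p₀ hG hH ht0] at hX
        have := Wiener.norm_nonlin_sub_le (norm_heat_le hG hp hG1 ht0) (norm_heat_le hH hp hH1 ht0)
          h1.1 h1.2 h2.1 h2.2
        rw [h3] at this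
        have h4 := ENNReal.ofReal_le_ofReal this
        rw [ENNReal.ofReal_add (by positivity) (by positivity), ENNReal.ofReal_mul (by norm_num),
          ENNReal.ofReal_mul (by norm_num), ENNReal.ofReal_mul (norm_nonneg _),
          ENNReal.ofReal_add (norm_nonneg _) (norm_nonneg _), ofReal_norm, ofReal_norm, ofReal_norm,
          ofReal_norm, ofReal_norm, ← mul_assoc] at h4
        refine h4.trans ?_
        gcongr
    _ = ENNReal.ofReal (15 / 49) * ∫⁻ t, ‖heatXX 0 (fun s => G s - H s) t‖ₑ ∂timeMeasure
        + ENNReal.ofReal (88 / 49) * d * ((∫⁻ t, ‖heatXX p₀ G t‖ₑ ∂timeMeasure)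
          + ∫⁻ t, ‖heatXX p₀ H t‖ₑ ∂timeMeasure) := by
        rw [lintegral_add_left' (hmd.const_mul _), lintegral_const_mul'' _ hmd,
          lintegral_const_mul'' _ (hmG.fun_add hmH), lintegral_add_left' hmG]
    _ ≤ ENNReal.ofReal (15 / 49) * d + ENNReal.ofReal (88 / 49) * d
          * (ENNReal.ofReal (1 / 8) + ENNReal.ofReal (1 / 8)) := by gcongr
    _ = _ := by
        rw [← ENNReal.ofReal_add (by norm_num) (by norm_num), mul_right_comm, ← add_mul,
          ← ENNReal.ofReal_mul (by norm_num), ← ENNReal.ofReal_add (by norm_num) (by norm_num)]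
        norm_num

theorem exists_fixedPoint (hp : ‖p₀‖ ≤ 1 / 10) : ∃ G : ℝ → Wiener, Integrable G timeMeasure ∧
    ∫⁻ s, ‖G s‖ₑ ∂timeMeasure ≤ ENNReal.ofReal (1 / 40) ∧
      ∀ᵐ t ∂timeMeasure, G t = source p₀ G t := by
  classical
  let Φ : (ℝ →₁[timeMeasure] Wiener) → (ℝ →₁[timeMeasure] Wiener) := fun G =>
    if h : Integrable (source p₀ G) timeMeasure then h.toL1 _ else 0
  let S : Set (ℝ →₁[timeMeasure] Wiener) := Metric.closedEBall 0 (ENNReal.ofReal (1 / 40))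
  have hmass : ∀ G ∈ S, ∫⁻ s, ‖G s‖ₑ ∂timeMeasure ≤ ENNReal.ofReal (1 / 40) := fun G hG => by
    have := hG
    rw [Metric.mem_closedEBall, edist_zero_right, Lp.enorm_def,
      eLpNorm_one_eq_lintegral_enorm] at this
    exact this
  have hint : ∀ G ∈ S, Integrable (source p₀ G) timeMeasure := fun G hG =>
    ⟨aestronglyMeasurable_source (L1.integrable_coeFn G) hp (hmass G hG),
      (lintegral_source_le (L1.integrable_coeFn G) hp (hmass G hG)).trans_lt ENNReal.ofReal_lt_top⟩
  have hΦ : ∀ G (hG : G ∈ S), Φ G = (hint G hG).toL1 _ := fun G hG => dif_pos (hint G hG)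
  have hmaps : MapsTo Φ S S := fun G hG => by
    rw [hΦ G hG, Metric.mem_closedEBall, edist_zero_right, Integrable.enorm_toL1]
    exact lintegral_source_le (L1.integrable_coeFn G) hp (hmass G hG)
  have hcontr : ContractingWith (37 / 49) (hmaps.restrict Φ S S) := by
    refine ⟨by rw [div_lt_one] <;> norm_num, fun G H => ?_⟩
    have h := lintegral_source_sub_le (L1.integrable_coeFn G.1) (L1.integrable_coeFn H.1) hp
      (hmass G.1 G.2) (hmass H.1 H.2)
    rw [Subtype.edist_eq, Subtype.edist_eq, MapsTo.val_restrict_apply, MapsTo.val_restrict_apply,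
      hΦ _ G.2, hΦ _ H.2, Integrable.edist_toL1_toL1, Lp.edist_def, eLpNorm_one_eq_lintegral_enorm]
    simp only [edist_eq_enorm_sub]
    refine h.trans_eq ?_
    congr 1
    rw [ENNReal.ofReal]
    norm_cast
    rw [Real.toNNReal_div (by norm_num)]
    simp
  have h0 : (0 : ℝ →₁[timeMeasure] Wiener) ∈ S := Metric.mem_closedEBall_self
  obtain ⟨G, hGS, hfix, -⟩ := hcontr.exists_fixedPoint'
    Metric.isClosed_closedEBall.isComplete hmaps h0 (edist_ne_top _ _)
  refine ⟨G, L1.integrable_coeFn G, hmass G hGS, ?_⟩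
  have h1 := (hint G hGS).coeFn_toL1
  rw [← hΦ G hGS, hfix] at h1
  exact h1

end FixedPoint

namespace Wiener

/-! ### Recovering the equation -/

theorem norm_antiSymbol_le (k : ℤ) : ‖(Complex.I * k)⁻¹‖ ≤ 1 := by
  rw [norm_inv, norm_mul, Complex.norm_I, one_mul, Complex.norm_intCast]
  rcases eq_or_ne k 0 with rfl | hk
  · simp
  · exact inv_le_one_of_one_le₀ (by exact_mod_cast Int.one_le_abs hk)

/-- The antiderivative of mean zero. -/
def antideriv : Wiener →L[ℝ] Wiener := mult (fun k => (Complex.I * k)⁻¹) 1 norm_antiSymbol_le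

theorem antideriv_apply (a : Wiener) (k : ℤ) : antideriv a k = (Complex.I * k)⁻¹ * a k := rfl

theorem norm_antideriv_le (a : Wiener) : ‖antideriv a‖ ≤ ‖a‖ :=
  (norm_mult_le _ 1 _ a).trans_eq (one_mul _)

theorem I_mul_ne_zero {k : ℤ} (hk : k ≠ 0) : (Complex.I * k : ℂ) ≠ 0 :=
  mul_ne_zero Complex.I_ne_zero (by exact_mod_cast hk)

theorem isDeriv_antideriv {a : Wiener} (ha : a 0 = 0) : IsDeriv (antideriv a) a := fun k => by
  rcases eq_or_ne k 0 with rfl | hk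
  · simp [ha]
  · rw [antideriv_apply, mul_inv_cancel_left₀ (I_mul_ne_zero hk)]

theorem conj_apply {a : Wiener} (ha : conjL a = a) (k : ℤ) : conj (a (-k)) = a k :=
  DFunLike.congr_fun ha k

theorem conjL_antideriv {a : Wiener} (ha : conjL a = a) : conjL (antideriv a) = antideriv a :=
  ext fun k => by
    rw [conjL_apply, antideriv_apply, antideriv_apply, map_mul, conj_apply ha, map_inv₀, map_mul]
    simp

theorem conjL_of_isDeriv {a b : Wiener} (h : IsDeriv a b) (ha : conjL a = a) : conjL b = b :=
  ext fun k => by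
    rw [conjL_apply, h, h, map_mul, conj_apply ha, map_mul]
    simp

theorem IsDeriv.imL {a b : Wiener} (h : IsDeriv a b) : IsDeriv (imL a) (imL b) := fun k => by
  rw [imL_eq, imL_eq, smul_apply, smul_apply, sub_apply, sub_apply, conjL_apply, conjL_apply, h k,
    h (-k)]
  simp only [map_mul, Complex.conj_I, map_intCast]
  push_cast
  ring

theorem IsDeriv.zMap {a b : Wiener} (h : IsDeriv a b) : IsDeriv (zMap a) (zMap b) := fun k => by
  rw [zMap_apply, zMap_apply, reL_eq, reL_eq, real_smul_apply, real_smul_apply, add_apply,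
    add_apply, conjL_apply, conjL_apply, h k, h (-k)]
  simp only [map_mul, Complex.conj_I, map_intCast]
  push_cast
  ring

/-- For real `p` of mean zero and `w` its antiderivative, `zMap p = w + i p`. -/
theorem zMap_eq {a : Wiener} (ha : conjL a = a) (h0 : a 0 = 0) :
    zMap a = antideriv a + Complex.I • a := ext fun k => by
  rw [zMap_apply, reL_of_conjL_eq ha, add_apply, antideriv_apply, smul_apply, zSymbol]
  rcases eq_or_ne k 0 with rfl | hk
  · simp [h0]
  · have hk' : (k : ℂ) ≠ 0 := by exact_mod_cast hk
    have := Complex.I_ne_zero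
    field_simp
    linear_combination (-(k * a k : ℂ)) * Complex.I_sq

theorem ev_im_eq_zero {a : Wiener} (ha : conjL a = a) (x : S1) : (ev a x).im = 0 := by
  have h := ev_conjL a x
  rw [ha] at h
  exact Complex.conj_eq_iff_im.mp h.symm

theorem ev_eq_re {a : Wiener} (ha : conjL a = a) (x : S1) : ev a x = ((ev a x).re : ℂ) :=
  Complex.ext (by simp) (by simp [ev_im_eq_zero ha])

theorem imL_zMap {a : Wiener} (ha : conjL a = a) (h0 : a 0 = 0) : imL (zMap a) = a := by
  refine ev_injective (ContinuousMap.ext fun x => ?_)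
  rw [ev_imL, zMap_eq ha h0, map_add, map_smul, ContinuousMap.add_apply, ContinuousMap.smul_apply,
    ev_eq_re ha, ev_eq_re (conjL_antideriv ha)]
  simp

/-- The flux `arctan (∂ₓw / (1 + w))`, in terms of `p = ∂ₓw`. -/
def flux (p : Wiener) (x : S1) : ℝ := Real.arctan ((ev p x).re / (1 + (ev (antideriv p) x).re))

theorem one_add_re_pos {p : Wiener} (hp : ‖p‖ ≤ 1 / 8) (x : S1) :
    0 < 1 + (ev (antideriv p) x).re := by
  have h := (Complex.abs_re_le_norm _).trans
    ((norm_ev_apply_le (antideriv p) x).trans ((norm_antideriv_le p).trans hp))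
  linarith [neg_abs_le (ev (antideriv p) x).re]

/-- The derivative of the flux is `Im (z' / (1 + z))`, since the flux is `Im log (1 + z)`. -/
theorem hasDerivAt_flux {p px : Wiener} (hp : ‖p‖ ≤ 1 / 8) (hr : conjL p = p) (h0 : p 0 = 0)
    (h : IsDeriv p px) (y : ℝ) : HasDerivAt (fun z : ℝ => flux p (z : S1))
      (ev (imL (zMap px * invOneAdd (zMap p))) (y : S1)).re y := by
  have hrx := conjL_of_isDeriv h hr
  have hx0 : px 0 = 0 := by rw [h 0, h0]; simp
  have hz : ‖zMap p‖ < 1 := ((norm_zMap_le p).trans hp).trans_lt (by norm_num)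
  have re_deriv : ∀ {a b : Wiener}, IsDeriv a b →
      HasDerivAt (fun z : ℝ => (ev a (z : S1)).re) (ev b (y : S1)).re y := fun hab =>
    Complex.reCLM.hasFDerivAt.comp_hasDerivAt y (hab.hasDerivAt y)
  have hW := re_deriv (isDeriv_antideriv h0)
  have hP := re_deriv h
  have hpos := one_add_re_pos hp (y : S1)
  have hd := (hP.fun_div (hW.const_add 1) hpos.ne').arctan
  refine hd.congr_deriv ?_
  have hinv : ev (invOneAdd (zMap p)) (y : S1) = (1 + ev (zMap p) (y : S1))⁻¹ := by
    refine eq_inv_of_mul_eq_one_right ?_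
    have := congrArg (fun a => ev a (y : S1)) (one_add_mul_invOneAdd hz)
    simpa using this
  have hanti : antideriv px = p := ext fun k => by
    rw [antideriv_apply, h k]
    rcases eq_or_ne k 0 with rfl | hk
    · simp [h0]
    · rw [inv_mul_cancel_left₀ (I_mul_ne_zero hk)]
  rw [ev_imL, ev_mul, ContinuousMap.mul_apply, hinv, zMap_eq hr h0, zMap_eq hrx hx0, hanti,
    Complex.ofReal_re]
  simp only [map_add, map_smul, ContinuousMap.add_apply, ContinuousMap.smul_apply, smul_eq_mul]
  rw [ev_eq_re hr, ev_eq_re hrx, ev_eq_re (conjL_antideriv hr)]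
  set W := (ev (antideriv p) (y : S1)).re
  set P := (ev p (y : S1)).re
  set Q := (ev px (y : S1)).re
  rw [← div_eq_mul_inv, Complex.div_im]
  simp [Complex.normSq_apply]
  have h1 : 0 < (1 + W) * (1 + W) + P * P := by
    nlinarith [mul_self_nonneg P, mul_pos hpos hpos]
  field_simp

/-- The equation in the Wiener algebra: the antiderivative of `∂ₓ²p + nonlin p` is the derivative of
the flux. -/
theorem antideriv_add_nonlin {p px pxx : Wiener} (hp : ‖p‖ ≤ 1 / 8) (hr : conjL p = p)
    (h0 : p 0 = 0) (h : IsDeriv p px) (h' : IsDeriv px pxx) :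
    antideriv (pxx + nonlin p px pxx) = imL (zMap px * invOneAdd (zMap p)) := by
  have hz : ‖zMap p‖ < 1 := ((norm_zMap_le p).trans hp).trans_lt (by norm_num)
  have hrx := conjL_of_isDeriv h hr
  have hx0 : px 0 = 0 := by rw [h 0, h0]; simp
  have hrxx := conjL_of_isDeriv h' hrx
  have hxx0 : pxx 0 = 0 := by rw [h' 0, hx0]; simp
  have hinv := one_add_mul_invOneAdd hz
  have hder := (h'.zMap.mul (h.zMap.one_add.inv hinv)).imL
  refine ext fun k => ?_
  rcases eq_or_ne k 0 with rfl | hk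
  · -- the mean of a derivative vanishes
    have hm := fourierCoeff_derivative (f := fun x => (flux p x : ℂ))
      (f' := ev (imL (zMap px * invOneAdd (zMap p)))) (ContinuousMap.continuous _) (fun y => by
        have hd := (hasDerivAt_flux hp hr h0 h y).ofReal_comp
        rwa [← ev_eq_re (conjL_imL _)] at hd) 0
    rw [fourierCoeff_ev] at hm
    rw [hm, antideriv_apply]
    simp
  · have e1 : (pxx + nonlin p px pxx) k = imL (zMap pxx * invOneAdd (zMap p)
        + zMap px * -(zMap px * (invOneAdd (zMap p) * invOneAdd (zMap p)))) k := by
      rw [add_apply, nonlin, neg_apply, meanFree_apply, if_neg hk]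
      have e2 : pxx k = imL (zMap pxx) k := by rw [imL_zMap hrxx hxx0]
      rw [e2, ← sub_eq_add_neg, ← sub_apply, ← map_sub, logNonlin]
      congr 2
      linear_combination (-zMap pxx) * hinv
    rw [antideriv_apply, e1, hder k, inv_mul_cancel_left₀ (I_mul_ne_zero hk)]

/-- Integration against a continuous function on the circle. -/
def pairing (φ : S1 → ℝ) (hφ : Continuous φ) : Wiener →L[ℝ] ℝ :=
  LinearMap.mkContinuousOfExistsBound
    { toFun := fun a => ∫ x, (ev a x).re * φ x
      map_add' := fun a b => by
        rw [← integral_add (integrable_S1 (by fun_prop)) (integrable_S1 (by fun_prop))]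
        simp [add_mul]
      map_smul' := fun c a => by
        have : ∀ x, ev (c • a) x = c • ev a x := fun x => by
          have := ev.map_smul (c : ℂ) a
          rw [RCLike.real_smul_eq_coe_smul (K := ℂ) c a]
          erw [this]
          simp
        simp only [this, RingHom.id_apply, smul_eq_mul, ← integral_const_mul]
        simp [mul_assoc] }
    ⟨∫ x, |φ x|, fun a => by
      simp only [LinearMap.coe_mk, AddHom.coe_mk]
      refine (norm_integral_le_of_norm_le (g := fun x => ‖a‖ * |φ x|) (integrable_S1 (by fun_prop))
        (ae_of_all _ fun x => ?_)).trans_eq ((integral_const_mul _ _).trans (mul_comm _ _))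
      rw [norm_mul, Real.norm_eq_abs, Real.norm_eq_abs]
      gcongr
      exact (Complex.abs_re_le_norm _).trans (norm_ev_apply_le a x)⟩

@[simp] theorem pairing_apply (φ : S1 → ℝ) (hφ : Continuous φ) (a : Wiener) :
    pairing φ hφ a = ∫ x, (ev a x).re * φ x := rfl

end Wiener

open Wiener in
/-- Existence in terms of `p = ∂ₓw`, for the equation with mean value `1`. -/
theorem exists_profile {p₀ : Wiener} (hp : ‖p₀‖ ≤ 1 / 10) (hr : conjL p₀ = p₀) (h0 : p₀ 0 = 0) :
    ∃ p pxx : ℝ → Wiener, ContinuousOn p (Ici 0) ∧ p 0 = p₀ ∧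
      (∀ t, 0 ≤ t → ‖p t‖ ≤ 1 / 8 ∧ conjL (p t) = p t ∧ p t 0 = 0) ∧
      (∀ φ φ' : S1 → ℝ, Continuous φ' →
        (∀ y : ℝ, HasDerivAt (fun z : ℝ => φ (z : S1)) (φ' (y : S1)) y) → ∀ t, 0 ≤ t →
        ∫ x, (ev (antideriv (p t)) x).re * φ x = (∫ x, (ev (antideriv p₀) x).re * φ x)
          - ∫ s in (0 : ℝ)..t, ∫ x, flux (p s) x * φ' x) ∧
      Integrable pxx timeMeasure ∧
      ∀ᵐ t ∂timeMeasure, ∀ k : ℤ, pxx t k = Complex.I * k * (Complex.I * k * p t k) := by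
  obtain ⟨G, hG, hG1, hfix⟩ := exists_fixedPoint hp
  have hbound : ∀ t, 0 ≤ t → ‖heat p₀ G t‖ ≤ 1 / 8 := fun t ht => norm_heat_le hG hp hG1 ht
  have hae : ∀ t, 0 ≤ t → ∀ P : ℝ → Prop, (∀ᵐ s ∂timeMeasure, P s) →
      ∀ᵐ s, s ∈ uIoc 0 t → P s := fun t ht P hP => by
    rw [uIoc_of_le ht, ← ae_restrict_iff' measurableSet_Ioc]
    exact ae_mono (Measure.restrict_mono Ioc_subset_Ioi_self le_rfl) hP
  have hreal : ∀ t, 0 ≤ t → conjL (heat p₀ G t) = heat p₀ G t := fun t ht => by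
    refine ext fun k => ?_
    rw [conjL_apply, heat_apply hG ht, heat_apply hG ht, mode, mode, duhamel, duhamel]
    simp only [Complex.real_smul, map_mul, map_add, Complex.conj_ofReal, conj_apply hr,
      Int.cast_neg, neg_sq]
    rw [intervalIntegral.integral_of_le ht, intervalIntegral.integral_of_le ht, ← integral_conj,
      ← intervalIntegral.integral_of_le ht, ← intervalIntegral.integral_of_le ht]
    congr 2
    refine intervalIntegral.integral_congr_ae ((hae t ht _ hfix).mono fun s hs hst => ?_)
    rw [map_mul, Complex.conj_ofReal, hs hst, source, conj_apply (conjL_nonlin _ _ _)]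
  have hzero : ∀ t, 0 ≤ t → heat p₀ G t 0 = 0 := fun t ht => by
    rw [heat_apply hG ht, mode, duhamel, h0, zero_add]
    rw [intervalIntegral.integral_congr_ae (g := fun _ => (0 : ℂ))
      ((hae t ht _ hfix).mono fun s hs hst => ?_)]
    · simp
    · rw [hs hst, source, nonlin, neg_apply, meanFree_apply]
      simp
  refine ⟨heat p₀ G, heatXX p₀ G, continuousOn_heat hG, heat_zero hG,
    fun t ht => ⟨hbound t ht, hreal t ht, hzero t ht⟩, ?_, integrable_heatXX hG, ?_⟩
  · intro φ φ' hφ' hφ t ht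
    have hφc := continuous_of_hasDerivAt hφ
    have hi : IntervalIntegrable (fun s => heatXX p₀ G s + G s) volume 0 t :=
      intervalIntegrable_of_Ioc ht (((integrable_heatXX hG).add hG).mono_measure
        (Measure.restrict_mono Ioc_subset_Ioi_self le_rfl))
    have h1 := ((pairing φ hφc).comp antideriv).intervalIntegral_comp_comm hi
    have h2 := congrArg ((pairing φ hφc).comp antideriv) (heat_eq_add_integral (p₀ := p₀) hG ht)
    rw [map_add, ← h1] at h2
    simp only [ContinuousLinearMap.comp_apply, pairing_apply] at h2
    rw [h2, sub_eq_add_neg, ← intervalIntegral.integral_neg]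
    congr 1
    refine intervalIntegral.integral_congr_ae ?_
    refine hae t ht _ ?_
    filter_upwards [hfix, ae_isDeriv_heat (p₀ := p₀) hG, ae_restrict_mem measurableSet_Ioi]
      with s hs hd hs0
    have hs0 := (mem_Ioi.mp hs0).le
    have e1 := antideriv_add_nonlin (hbound s hs0) (hreal s hs0) (hzero s hs0) hd.1 hd.2
    rw [← source, ← hs] at e1
    rw [e1]
    exact integral_mul_derivative (f := flux (heat p₀ G s)) (by fun_prop) hφ'
      (hasDerivAt_flux (hbound s hs0) (hreal s hs0) (hzero s hs0) hd.1) hφ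
  · filter_upwards [ae_isDeriv_heat (p₀ := p₀) hG] with t hd k
    rw [hd.2 k, hd.1 k]

/-! ### Uniqueness -/

/-- Parseval's identity. -/
theorem hasSum_conj_fourierC_mul {f g : S1 → ℝ} (hf : Continuous f) (hg : Continuous g) :
    HasSum (fun k => (conj (fourierC f k) * fourierC g k).re)
      (∫ x, f x * g x ∂AddCircle.haarAddCircle) := by
  let F : C(S1, ℂ) := ⟨fun x => f x, by fun_prop⟩
  let H : C(S1, ℂ) := ⟨fun x => g x, by fun_prop⟩
  let L : C(S1, ℂ) →L[ℂ] Lp ℂ 2 (AddCircle.haarAddCircle (T := 2 * Real.pi)) :=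
    ContinuousMap.toLp 2 _ ℂ
  have hL : ∀ (F : C(S1, ℂ)) k, inner ℂ (fourierBasis k) (L F) = fourierCoeff F k := fun F k => by
    rw [← HilbertBasis.repr_apply_apply, fourierBasis_repr, fourierCoeff_toLp]
  have h := fourierBasis.hasSum_inner_mul_inner (L F) (L H)
  have h2 : inner ℂ (L F) (L H) = ((∫ x, f x * g x ∂AddCircle.haarAddCircle : ℝ) : ℂ) := by
    rw [L2.inner_def, ← integral_complex_ofReal]
    refine integral_congr_ae ?_
    filter_upwards [ContinuousMap.coeFn_toLp (p := 2) (𝕜 := ℂ) AddCircle.haarAddCircle F,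
      ContinuousMap.coeFn_toLp (p := 2) (𝕜 := ℂ) AddCircle.haarAddCircle H] with x h1 h2
    rw [h1, h2]
    simp [F, H, mul_comm]
  rw [h2] at h
  have h3 := Complex.reCLM.hasSum h
  simp only [Complex.reCLM_apply, Complex.ofReal_re] at h3
  refine h3.congr_fun ?_
  intro k
  rw [← inner_conj_symm, hL, hL]
  rfl

theorem hasSum_norm_fourierC_sq {f : S1 → ℝ} (hf : Continuous f) :
    HasSum (fun k => ‖fourierC f k‖ ^ 2) (∫ x, f x ^ 2 ∂AddCircle.haarAddCircle) := by
  have h := hasSum_conj_fourierC_mul hf hf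
  simp only [← Complex.normSq_eq_conj_mul_self, Complex.ofReal_re, Complex.normSq_eq_norm_sq,
    ← pow_two] at h
  exact h

theorem fourierC_eq_integral (f : S1 → ℝ) (k : ℤ) :
    fourierC f k = (2 * Real.pi : ℂ)⁻¹ * ∫ x, (f x : ℂ) * fourier (-k) x :=
  fourierCoeff_eq_integral _ k

theorem integral_ofReal_mul {f : S1 → ℝ} (hf : Integrable f) {F : S1 → ℂ} (hF : Continuous F) :
    ∫ x, (f x : ℂ) * F x = ((∫ x, f x * (F x).re : ℝ) : ℂ)
      + Complex.I * ((∫ x, f x * (F x).im : ℝ) : ℂ) := by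
  obtain ⟨C, hC⟩ := (isCompact_range hF).isBounded.exists_norm_le
  have hC' : ∀ x, ‖F x‖ ≤ C := fun x => hC _ ⟨x, rfl⟩
  have h1 : Integrable fun x => f x * (F x).re :=
    hf.mul_bdd (by fun_prop : Continuous _).aestronglyMeasurable
      (ae_of_all _ fun x => (Complex.abs_re_le_norm _).trans (hC' x))
  have h2 : Integrable fun x => f x * (F x).im :=
    hf.mul_bdd (by fun_prop : Continuous _).aestronglyMeasurable
      (ae_of_all _ fun x => (Complex.abs_im_le_norm _).trans (hC' x))
  rw [← integral_complex_ofReal, ← integral_complex_ofReal, ← integral_const_mul,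
    ← integral_add h1.ofReal (h2.ofReal.const_mul _)]
  refine integral_congr_ae (ae_of_all _ fun x => ?_)
  simp only [Complex.ofReal_mul]
  conv_lhs => rw [← Complex.re_add_im (F x)]
  ring

theorem continuous_parametric_integral {f : ℝ → S1 → ℝ} (hf : Continuous (Function.uncurry f))
    {μ : Measure S1} [IsFiniteMeasure μ] : Continuous fun t => ∫ x, f t x ∂μ := by
  have h := continuous_parametric_integral_of_continuous (μ := μ) hf isCompact_univ
  simpa only [Measure.restrict_univ] using h

theorem continuous_fourierC {f : ℝ → S1 → ℝ} (hf : Continuous (Function.uncurry f)) (k : ℤ) :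
    Continuous fun t => fourierC (f t) k := by
  have h : Continuous (Function.uncurry fun (t : ℝ) (x : S1) => (f t x : ℂ) * fourier (-k) x) :=
    (Complex.continuous_ofReal.comp hf).mul ((fourier (-k)).continuous.comp continuous_snd)
  have h2 := continuous_parametric_integral_of_continuous (μ := volume) h isCompact_univ
  simp only [Measure.restrict_univ] at h2
  simp only [fourierC_eq_integral]
  exact h2.const_mul _

theorem contDiff_fourier (k : ℤ) :
    ContDiff ℝ (⊤ : ℕ∞) fun y : ℝ => (fourier k (y : S1) : ℂ) := by
  simp only [fourier_coe_apply]
  exact Complex.contDiff_exp.comp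
    ((contDiff_const.mul Complex.ofRealCLM.contDiff).div_const _)

/-- The energy estimate: a difference `d` of two solutions, with `∂ₜd = ∂ₓg` weakly, vanishes if
`g ∂ₓd ≥ -C d²`. -/
theorem eq_zero_of_energy {d e g : ℝ → S1 → ℝ} {T C : ℝ}
    (hd : Continuous (Function.uncurry d)) (he : Continuous (Function.uncurry e))
    (hg : Continuous (Function.uncurry g))
    (hde : ∀ s, ∀ y : ℝ, HasDerivAt (fun z : ℝ => d s (z : S1)) (e s (y : S1)) y)
    (heq : ∀ φ φ' : S1 → ℝ, ContDiff ℝ (⊤ : ℕ∞) (fun y : ℝ => φ (y : S1)) →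
      Continuous φ' → (∀ y : ℝ, HasDerivAt (fun z : ℝ => φ (z : S1)) (φ' (y : S1)) y) →
      ∀ t ∈ Icc 0 T,
      ∫ x, d t x * φ x = -∫ s in (0 : ℝ)..t, ∫ x, g s x * φ' x)
    (hmono : ∀ s x, -(C * d s x ^ 2) ≤ g s x * e s x) :
    ∀ t ∈ Icc 0 T, ∀ x, d t x = 0 := by
  have hdc : ∀ s, Continuous (d s) := fun s => hd.comp (by fun_prop : Continuous fun x => (s, x))
  have hec : ∀ s, Continuous (e s) := fun s => he.comp (by fun_prop : Continuous fun x => (s, x))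
  have hgc : ∀ s, Continuous (g s) := fun s => hg.comp (by fun_prop : Continuous fun x => (s, x))
  -- the equation for the Fourier coefficients
  have h1 : ∀ k : ℤ, ∀ t ∈ Icc 0 T,
      fourierC (d t) k = Complex.I * k * ∫ s in (0 : ℝ)..t, fourierC (g s) k := by
    intro k t ht
    have hF := hasDerivAt_fourier_S1 (-k)
    have hF2 := contDiff_fourier (-k)
    have a1 := heq (fun x => (fourier (-k) x : ℂ).re)
      (fun x => (Complex.I * (-k : ℤ) * fourier (-k) x).re)
      (Complex.reCLM.contDiff.comp hF2) (by fun_prop)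
      (fun y => Complex.reCLM.hasFDerivAt.comp_hasDerivAt y (hF y)) t ht
    have a2 := heq (fun x => (fourier (-k) x : ℂ).im)
      (fun x => (Complex.I * (-k : ℤ) * fourier (-k) x).im)
      (Complex.imCLM.contDiff.comp hF2) (by fun_prop)
      (fun y => Complex.imCLM.hasFDerivAt.comp_hasDerivAt y (hF y)) t ht
    have hgF : ∀ Ψ : S1 → ℝ, Continuous Ψ → Continuous fun s => ∫ x, g s x * Ψ x := fun Ψ hΨ =>
      continuous_parametric_integral (f := fun s x => g s x * Ψ x)
        (hg.mul (hΨ.comp continuous_snd))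
    have a3 : ∫ x, (d t x : ℂ) * fourier (-k) x
        = -∫ s in (0 : ℝ)..t, ∫ x, (g s x : ℂ) * (Complex.I * (-k : ℤ) * fourier (-k) x) := by
      rw [integral_ofReal_mul (integrable_S1 (hdc t)) (by fun_prop), a1, a2]
      simp only [fun s => integral_ofReal_mul (integrable_S1 (hgc s))
        (F := fun x => Complex.I * (-k : ℤ) * fourier (-k) x) (by fun_prop)]
      rw [intervalIntegral.integral_add, intervalIntegral.integral_const_mul,
        intervalIntegral.integral_ofReal, intervalIntegral.integral_ofReal]
      · push_cast; ring
      · exact (Complex.continuous_ofReal.comp (hgF _ (by fun_prop))).intervalIntegrable _ _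
      · exact ((Complex.continuous_ofReal.comp (hgF _ (by fun_prop))).const_mul
          _).intervalIntegrable _ _
    have a4 : ∀ s, ∫ x, (g s x : ℂ) * (Complex.I * (-k : ℤ) * fourier (-k) x)
        = (-(Complex.I * k)) * ∫ x, (g s x : ℂ) * fourier (-k) x := fun s => by
      rw [← integral_const_mul]
      refine integral_congr_ae (ae_of_all _ fun x => ?_)
      simp only; push_cast; ring
    simp only [fourierC_eq_integral, intervalIntegral.integral_const_mul]
    rw [a3]
    simp only [a4, intervalIntegral.integral_const_mul]
    ring
  have h2 : ∀ (k : ℤ) s, fourierC (e s) k = Complex.I * k * fourierC (d s) k := fun k s =>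
    fourierCoeff_derivative (by fun_prop) (fun y => (hde s y).ofReal_comp) k
  -- the energy identity for one Fourier mode
  have h3 : ∀ k : ℤ, ∀ t ∈ Icc 0 T, ‖fourierC (d t) k‖ ^ 2
      = ∫ s in (0 : ℝ)..t, -2 * (conj (fourierC (e s) k) * fourierC (g s) k).re := by
    intro k t ht
    have hgk := continuous_fourierC hg k
    set c : ℝ → ℂ := fun t => Complex.I * k * ∫ s in (0 : ℝ)..t, fourierC (g s) k
    have hc : ∀ s, HasDerivAt c (Complex.I * k * fourierC (g s) k) s := fun s =>
      (intervalIntegral.integral_hasDerivAt_right (hgk.intervalIntegrable _ _)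
        hgk.stronglyMeasurable.stronglyMeasurableAtFilter hgk.continuousAt).const_mul _
    have hcc : Continuous c := continuous_iff_continuousAt.mpr fun s => (hc s).continuousAt
    have hint := intervalIntegral.integral_eq_sub_of_hasDerivAt (a := 0) (b := t)
      (fun s _ => (hc s).norm_sq)
      ((by fun_prop : Continuous fun s => 2 * inner ℝ (c s)
        (Complex.I * k * fourierC (g s) k)).intervalIntegrable _ _)
    have hc0 : c 0 = 0 := by simp [c]
    have hct : c t = fourierC (d t) k := (h1 k t ht).symm
    rw [hc0, hct] at hint
    simp only [norm_zero, ne_eq, OfNat.ofNat_ne_zero, not_false_eq_true, zero_pow, sub_zero] at hint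
    rw [← hint]
    refine intervalIntegral.integral_congr fun s hs => ?_
    rw [uIcc_of_le ht.1] at hs
    rw [h2, h1 k s ⟨hs.1, hs.2.trans ht.2⟩, Complex.inner]
    change 2 * (_ * conj (c s)).re = -2 * (conj (Complex.I * k * c s) * _).re
    simp only [map_mul, Complex.conj_I, map_intCast]
    rw [← Complex.re_ofReal_mul, ← Complex.re_ofReal_mul]
    congr 1
    push_cast
    ring
  set E : ℝ → ℝ := fun t => ∫ x, d t x ^ 2 ∂AddCircle.haarAddCircle with hE
  have hEc : Continuous E :=
    continuous_parametric_integral (f := fun t x => d t x ^ 2) ((continuous_pow 2).comp hd)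
  -- the energy identity
  have h4 : ∀ t ∈ Icc 0 T,
      E t = ∫ s in (0 : ℝ)..t, -2 * ∫ x, e s x * g s x ∂AddCircle.haarAddCircle := by
    intro t ht
    refine (hasSum_norm_fourierC_sq (hdc t)).unique ?_
    simp only [h3 _ t ht]
    have hsum : ∀ s, HasSum (fun k => ‖fourierC (e s) k‖ ^ 2 + ‖fourierC (g s) k‖ ^ 2)
        ((∫ x, e s x ^ 2 ∂AddCircle.haarAddCircle) + ∫ x, g s x ^ 2 ∂AddCircle.haarAddCircle) :=
      fun s => (hasSum_norm_fourierC_sq (hec s)).add (hasSum_norm_fourierC_sq (hgc s))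
    refine intervalIntegral.hasSum_integral_of_dominated_convergence
      (fun k s => ‖fourierC (e s) k‖ ^ 2 + ‖fourierC (g s) k‖ ^ 2) (fun k => ?_)
      (fun k => ae_of_all _ fun s _ => ?_) (ae_of_all _ fun s _ => (hsum s).summable) ?_
      (ae_of_all _ fun s _ => ?_)
    · have := continuous_fourierC hg k
      have := continuous_fourierC he k
      exact (by fun_prop : Continuous fun s =>
        -2 * (conj (fourierC (e s) k) * fourierC (g s) k).re).aestronglyMeasurable
    · have := Complex.abs_re_le_norm (conj (fourierC (e s) k) * fourierC (g s) k)
      rw [norm_mul, Complex.norm_conj] at this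
      rw [norm_mul, Real.norm_eq_abs, Real.norm_eq_abs]
      rw [abs_neg, abs_two]
      nlinarith [sq_nonneg (‖fourierC (e s) k‖ - ‖fourierC (g s) k‖)]
    · simp only [(hsum _).tsum_eq]
      exact ((continuous_parametric_integral (f := fun t x => e t x ^ 2)
        ((continuous_pow 2).comp he)).add (continuous_parametric_integral
          (f := fun t x => g t x ^ 2) ((continuous_pow 2).comp hg))).intervalIntegrable _ _
    · exact (hasSum_conj_fourierC_mul (hec s) (hgc s)).mul_left (-2)
  have hE0 : ∀ t, 0 ≤ E t := fun t => integral_nonneg fun x => sq_nonneg _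
  set F : ℝ → ℝ := fun t => ∫ s in (0 : ℝ)..t, E s with hF
  have hF' : ∀ t, HasDerivAt F (E t) t := fun t =>
    intervalIntegral.integral_hasDerivAt_right (hEc.intervalIntegrable _ _)
      hEc.stronglyMeasurable.stronglyMeasurableAtFilter hEc.continuousAt
  have h5 : ∀ t ∈ Icc 0 T, E t ≤ 2 * C * F t := by
    intro t ht
    rw [h4 t ht, hF, ← intervalIntegral.integral_const_mul]
    refine intervalIntegral.integral_mono_on ht.1 ?_ ((hEc.const_mul _).intervalIntegrable _ _)
      fun s _ => ?_
    · exact ((continuous_parametric_integral (f := fun t x => e t x * g t x)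
        (he.mul hg)).const_mul _).intervalIntegrable _ _
    · have : -(C * E s) ≤ ∫ x, e s x * g s x ∂AddCircle.haarAddCircle := by
        rw [hE, ← integral_const_mul, ← integral_neg]
        have := hdc s; have := hec s; have := hgc s
        refine integral_mono (integrable_S1 (by fun_prop)) (integrable_S1 (by fun_prop)) fun x => ?_
        rw [mul_comm (e s x)]
        exact hmono s x
      linarith
  have h6 : ∀ t ∈ Icc 0 T, ‖F t‖ ≤ gronwallBound 0 (2 * C) 0 (t - 0) :=
    norm_le_gronwallBound_of_norm_deriv_right_le (f' := E)
      (fun t _ => (hF' t).continuousAt.continuousWithinAt) (fun t _ => (hF' t).hasDerivWithinAt)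
      (by simp [hF]) fun t ht => by
        have hF0 : 0 ≤ F t := intervalIntegral.integral_nonneg ht.1 fun s _ => hE0 s
        rw [Real.norm_of_nonneg (hE0 t), Real.norm_of_nonneg hF0, add_zero]
        exact h5 t ⟨ht.1, ht.2.le⟩
  intro t ht x
  have hFt := h6 t ht
  rw [gronwallBound_ε0_δ0] at hFt
  have hEt : E t = 0 := le_antisymm ((h5 t ht).trans (by rw [norm_le_zero_iff.mp hFt, mul_zero]))
    (hE0 t)
  have := hdc t
  have h7 := (integral_eq_zero_iff_of_nonneg (fun x => sq_nonneg (d t x))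
    (integrable_S1 (by fun_prop))).mp hEt
  have h8 := Measure.eq_of_ae_eq h7 (by fun_prop) continuous_const
  simpa using congrFun h8 x

/-- Uniform monotonicity of `arctan` on bounded sets. -/
theorem arctan_sub_mul_sub_ge {L x y : ℝ} (hx : |x| ≤ L) (hy : |y| ≤ L) :
    (x - y) ^ 2 / (1 + L ^ 2) ≤ (Real.arctan x - Real.arctan y) * (x - y) := by
  wlog hxy : y ≤ x generalizing x y
  · convert this hy hx (le_of_not_ge hxy) using 1 <;> ring
  have h := (convex_Icc (-L) L).mul_sub_le_image_sub_of_le_deriv (f := Real.arctan)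
    (C := 1 / (1 + L ^ 2)) Real.continuous_arctan.continuousOn
    Real.differentiable_arctan.differentiableOn (fun z hz => by
      simp only [Real.deriv_arctan]
      rw [interior_Icc] at hz
      have : z ^ 2 ≤ L ^ 2 := sq_le_sq' hz.1.le hz.2.le
      gcongr) y (abs_le.mp hy) x (abs_le.mp hx) hxy
  have h2 := mul_le_mul_of_nonneg_right h (sub_nonneg.mpr hxy)
  refine le_trans (le_of_eq ?_) h2
  ring

theorem abs_arctan_sub_le (x y : ℝ) : |Real.arctan x - Real.arctan y| ≤ |x - y| := by
  have h := Convex.norm_image_sub_le_of_norm_deriv_le (f := Real.arctan) (C := 1) (s := univ)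
    (x := y) (y := x) (fun z _ => Real.differentiable_arctan z) (fun z _ => by
      rw [Real.deriv_arctan, Real.norm_of_nonneg (by positivity)]
      exact div_le_one_of_le₀ (by nlinarith [sq_nonneg z]) (by positivity)) convex_univ
    (mem_univ _) (mem_univ _)
  simpa using h

/-- The flux is monotone in the derivative, up to an error quadratic in the difference of the
functions. -/
theorem flux_monotone {c M : ℝ} (hc : 0 < c) (hM : 0 < M) : ∃ C, ∀ a b p q : ℝ,
    c ≤ a → a ≤ M → c ≤ b → |p| ≤ M → |q| ≤ M →
    -(C * (a - b) ^ 2) ≤ (Real.arctan (p / a) - Real.arctan (q / b)) * (p - q) := by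
  set κ := 1 / (M * (1 + (M / c) ^ 2)) with hκ
  have hκ0 : 0 < κ := by positivity
  set l := M / c ^ 2 with hl
  refine ⟨l ^ 2 / (4 * κ), fun a b p q ha haM hb hp hq => ?_⟩
  have ha0 := hc.trans_le ha
  have hb0 := hc.trans_le hb
  have hdiv : ∀ p, |p| ≤ M → |p / a| ≤ M / c := fun p hp => by
    rw [abs_div, abs_of_pos ha0]; gcongr
  have h1 : κ * (p - q) ^ 2 ≤ (Real.arctan (p / a) - Real.arctan (q / a)) * (p - q) := by
    have h := mul_le_mul_of_nonneg_left (arctan_sub_mul_sub_ge (hdiv p hp) (hdiv q hq)) ha0.le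
    have e1 : a * ((Real.arctan (p / a) - Real.arctan (q / a)) * (p / a - q / a))
        = (Real.arctan (p / a) - Real.arctan (q / a)) * (p - q) := by field_simp
    have e2 : a * ((p / a - q / a) ^ 2 / (1 + (M / c) ^ 2))
        = 1 / (a * (1 + (M / c) ^ 2)) * (p - q) ^ 2 := by
      field_simp
    rw [e1, e2] at h
    refine le_trans ?_ h
    rw [hκ]
    gcongr
  have h2 : |Real.arctan (q / a) - Real.arctan (q / b)| ≤ l * |a - b| := by
    refine (abs_arctan_sub_le _ _).trans ?_
    have : q / a - q / b = -(q * (a - b) / (a * b)) := by field_simp; ring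
    rw [this, abs_neg, abs_div, abs_mul, abs_of_pos (mul_pos ha0 hb0), hl, div_mul_eq_mul_div,
      pow_two]
    gcongr
  have h3 : -(l * |a - b| * |p - q|)
      ≤ (Real.arctan (q / a) - Real.arctan (q / b)) * (p - q) := by
    refine le_trans ?_ (neg_abs_le _)
    rw [abs_mul]
    gcongr
  have h4 : 0 ≤ κ * |p - q| ^ 2 - l * |a - b| * |p - q| + l ^ 2 / (4 * κ) * |a - b| ^ 2 := by
    have : κ * |p - q| ^ 2 - l * |a - b| * |p - q| + l ^ 2 / (4 * κ) * |a - b| ^ 2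
        = κ * (|p - q| - l * |a - b| / (2 * κ)) ^ 2 := by field_simp; ring
    rw [this]
    positivity
  rw [sq_abs, sq_abs] at h4
  linarith

theorem IsPositiveSolution.hasDerivAt {u₀ : S1 → ℝ} {T : ℝ≥0∞} {u : ℝ → S1 → ℝ}
    (hu : IsPositiveSolution u₀ T u) {t : ℝ} (ht : t ∈ timeIco T) (y : ℝ) :
    HasDerivAt (fun z : ℝ => u t (z : S1)) (xDeriv (u t) (y : S1)) y :=
  S1.hasDerivAt_iff.mp (hu.differentiable t ht y).hasDerivAt

theorem xDeriv_eq {φ φ' : S1 → ℝ}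
    (h : ∀ y : ℝ, HasDerivAt (fun z : ℝ => φ (z : S1)) (φ' (y : S1)) y) : xDeriv φ = φ' := by
  funext x
  obtain ⟨y, rfl⟩ := QuotientAddGroup.mk_surjective x
  exact (S1.hasDerivAt_iff.mpr (h y)).deriv

theorem Icc_subset_timeIco {T : ℝ≥0∞} {t : ℝ} (ht : t ∈ timeIco T) : Icc 0 t ⊆ timeIco T :=
  fun _ hs => ⟨hs.1, (ENNReal.ofReal_le_ofReal hs.2).trans_lt ht.2⟩

theorem IsPositiveSolution.unique {u₀ : S1 → ℝ} {T : ℝ≥0∞} {u v : ℝ → S1 → ℝ}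
    (hu : IsPositiveSolution u₀ T u) (hv : IsPositiveSolution u₀ T v) {t : ℝ} (ht : t ∈ timeIco T) :
    u t = v t := by
  -- freezing the time variable outside `[0, t]` makes all functions globally continuous
  set π : ℝ → ℝ := fun s => max 0 (min s t) with hπ
  have hπc : Continuous π := by fun_prop
  have hπm : ∀ s, π s ∈ Icc 0 t := fun s => ⟨le_max_left _ _, max_le ht.1 (min_le_right _ _)⟩
  have hπT : ∀ s, π s ∈ timeIco T := fun s => Icc_subset_timeIco ht (hπm s)
  have hπi : ∀ s ∈ Icc 0 t, π s = s := fun s hs => by simp [hπ, hs.1, hs.2]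
  have hcont : ∀ f : ℝ → S1 → ℝ, ContinuousOn (fun q : ℝ × S1 => f q.1 q.2) (timeIco T ×ˢ univ) →
      Continuous (Function.uncurry fun s => f (π s)) := fun f hf =>
    hf.comp_continuous (f := fun q : ℝ × S1 => (π q.1, q.2)) (by fun_prop)
      fun q => ⟨hπT q.1, mem_univ _⟩
  have hK : IsCompact (Icc 0 t ×ˢ (univ : Set S1)) := isCompact_Icc.prod isCompact_univ
  have hne : (Icc 0 t ×ˢ (univ : Set S1)).Nonempty := ⟨(0, 0), ⟨le_rfl, ht.1⟩, mem_univ _⟩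
  have hlow : ∀ w : ℝ → S1 → ℝ, IsPositiveSolution u₀ T w →
      ∃ c, 0 < c ∧ ∀ s x, c ≤ w (π s) x := fun w hw => by
    obtain ⟨q, hq, hmin⟩ := hK.exists_isMinOn hne
      (hw.continuousOn.mono (prod_mono_left (Icc_subset_timeIco ht)))
    exact ⟨w q.1 q.2, hw.pos _ (Icc_subset_timeIco ht hq.1) _,
      fun s x => hmin (show (π s, x) ∈ _ from ⟨hπm s, mem_univ _⟩)⟩
  have hupp : ∀ f : ℝ → S1 → ℝ, ContinuousOn (fun q : ℝ × S1 => f q.1 q.2) (timeIco T ×ˢ univ) →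
      ∃ M, ∀ s x, |f (π s) x| ≤ M := fun f hf => by
    obtain ⟨M, hM⟩ := hK.exists_bound_of_continuousOn
      (hf.mono (prod_mono_left (Icc_subset_timeIco ht)))
    exact ⟨M, fun s x => hM (π s, x) ⟨hπm s, mem_univ _⟩⟩
  obtain ⟨c₁, hc₁, hu₁⟩ := hlow u hu
  obtain ⟨c₂, hc₂, hv₁⟩ := hlow v hv
  obtain ⟨M₁, hM₁⟩ := hupp u hu.continuousOn
  obtain ⟨M₂, hM₂⟩ := hupp (fun s => xDeriv (u s)) hu.continuousOn_xDeriv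
  obtain ⟨M₃, hM₃⟩ := hupp (fun s => xDeriv (v s)) hv.continuousOn_xDeriv
  obtain ⟨C, hmono⟩ := flux_monotone (lt_min hc₁ hc₂)
    (lt_max_of_lt_left one_pos : 0 < max 1 (max M₁ (max M₂ M₃)))
  have huc := hcont u hu.continuousOn
  have hvc := hcont v hv.continuousOn
  have huxc := hcont (fun s => xDeriv (u s)) hu.continuousOn_xDeriv
  have hvxc := hcont (fun s => xDeriv (v s)) hv.continuousOn_xDeriv
  have hflux : ∀ w : ℝ → S1 → ℝ, IsPositiveSolution u₀ T w →
      Continuous (Function.uncurry fun s x =>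
        Real.arctan (xDeriv (w (π s)) x / w (π s) x)) := fun w hw =>
    Real.continuous_arctan.comp ((hcont (fun s => xDeriv (w s)) hw.continuousOn_xDeriv).div₀
      (hcont w hw.continuousOn) fun q => (hw.pos _ (hπT q.1) q.2).ne')
  have key := eq_zero_of_energy (T := t) (C := C) (d := fun s x => u (π s) x - v (π s) x)
    (e := fun s x => xDeriv (u (π s)) x - xDeriv (v (π s)) x)
    (g := fun s x => Real.arctan (xDeriv (u (π s)) x / u (π s) x)
      - Real.arctan (xDeriv (v (π s)) x / v (π s) x))
    (huc.sub hvc) (huxc.sub hvxc) ((hflux u hu).sub (hflux v hv))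
    (fun s y => (hu.hasDerivAt (hπT s) y).sub (hv.hasDerivAt (hπT s) y)) ?_ ?_ t ⟨ht.1, le_rfl⟩
  · funext x
    have := key x
    rw [hπi t ⟨ht.1, le_rfl⟩] at this
    exact sub_eq_zero.mp this
  · intro φ φ' hφ hφ'c hφ' s hs
    have hφc := continuous_of_hasDerivAt hφ'
    have hsT := Icc_subset_timeIco ht hs
    have sub_int : ∀ (f h : ℝ → S1 → ℝ) (ψ : S1 → ℝ), Continuous (Function.uncurry f) →
        Continuous (Function.uncurry h) → Continuous ψ → ∀ r,
        ∫ x, (f r x - h r x) * ψ x = (∫ x, f r x * ψ x) - ∫ x, h r x * ψ x := by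
      intro f h ψ hf hh hψ r
      have h1 : Continuous (f r) := hf.comp (by fun_prop : Continuous fun x => (r, x))
      have h2 : Continuous (h r) := hh.comp (by fun_prop : Continuous fun x => (r, x))
      rw [← integral_sub (integrable_S1 (by fun_prop)) (integrable_S1 (by fun_prop))]
      simp only [sub_mul]
    have par : ∀ w : ℝ → S1 → ℝ, IsPositiveSolution u₀ T w → Continuous fun r =>
        ∫ x, Real.arctan (xDeriv (w (π r)) x / w (π r) x) * φ' x := fun w hw =>
      continuous_parametric_integral
        (f := fun r x => Real.arctan (xDeriv (w (π r)) x / w (π r) x) * φ' x)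
        ((hflux w hw).mul (hφ'c.comp continuous_snd))
    have eqn : ∀ w : ℝ → S1 → ℝ, IsPositiveSolution u₀ T w → ∫ x, w (π s) x * φ x
        = (∫ x, u₀ x * φ x) - ∫ r in (0 : ℝ)..s,
          ∫ x, Real.arctan (xDeriv (w (π r)) x / w (π r) x) * φ' x := fun w hw => by
      rw [hπi s hs, hw.equation φ hφ s hsT, xDeriv_eq hφ']
      congr 1
      refine intervalIntegral.integral_congr fun r hr => ?_
      rw [uIcc_of_le hs.1] at hr
      simp only [hπi r ⟨hr.1, hr.2.trans hs.2⟩]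
    simp only [sub_int _ _ _ huc hvc hφc, sub_int _ _ _ (hflux u hu) (hflux v hv) hφ'c]
    rw [eqn u hu, eqn v hv, intervalIntegral.integral_sub ((par u hu).intervalIntegrable _ _)
      ((par v hv).intervalIntegrable _ _)]
    ring
  · intro s x
    exact hmono _ _ _ _ ((min_le_left _ _).trans (hu₁ s x))
      ((le_abs_self _).trans ((hM₁ s x).trans ((le_max_left _ _).trans (le_max_right _ _))))
      ((min_le_right _ _).trans (hv₁ s x))
      ((hM₂ s x).trans ((le_max_left _ _).trans ((le_max_right _ _).trans (le_max_right _ _))))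
      ((hM₃ s x).trans ((le_max_right _ _).trans ((le_max_right _ _).trans (le_max_right _ _))))

/-! ### The initial datum -/

/-- An integrable function is determined by its Fourier coefficients. -/
theorem ae_eq_zero_of_fourierC {f : S1 → ℝ} (hf : Integrable f) (h : ∀ k, fourierC f k = 0) :
    f =ᵐ[volume] 0 := by
  have hb : ∀ φ : C(S1, ℂ), Integrable fun x => (f x : ℂ) * φ x := fun φ =>
    hf.ofReal.mul_bdd φ.continuous.aestronglyMeasurable (ae_of_all _ φ.norm_coe_le_norm)
  let L : C(S1, ℂ) →L[ℂ] ℂ := LinearMap.mkContinuous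
    { toFun := fun φ => ∫ x, (f x : ℂ) * φ x
      map_add' := fun φ ψ => by
        rw [← integral_add (hb φ) (hb ψ)]
        simp [mul_add]
      map_smul' := fun c φ => by
        rw [RingHom.id_apply, smul_eq_mul, ← integral_const_mul]
        simp [mul_left_comm] } (∫ x, ‖f x‖) fun φ => by
    refine (norm_integral_le_of_norm_le (hf.norm.mul_const ‖φ‖) (ae_of_all _ fun x => ?_)).trans_eq
      (integral_mul_const _ _)
    rw [norm_mul, Complex.norm_real]
    gcongr
    exact φ.norm_coe_le_norm x
  -- trigonometric polynomials are dense in `C(S1, ℂ)`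
  have hL : ∀ φ, L φ = 0 := fun φ => by
    have hker : (Submodule.span ℂ (range (fourier (T := 2 * Real.pi)))).topologicalClosure
        ≤ LinearMap.ker L.toLinearMap := by
      refine Submodule.topologicalClosure_minimal _ (Submodule.span_le.mpr ?_) L.isClosed_ker
      rintro _ ⟨k, rfl⟩
      have h1 := h (-k)
      rw [fourierC_eq_integral, neg_neg, mul_eq_zero_iff_left (by simp [Real.pi_ne_zero])] at h1
      exact h1
    rw [span_fourier_closure_eq_top] at hker
    exact hker (Submodule.mem_top (x := φ))
  -- hence the positive and the negative part of `f` are densities of the same measure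
  have hfin : ∀ g : S1 → ℝ, Integrable g → ∫⁻ x, ENNReal.ofReal (g x) ≠ ∞ := fun g hg =>
    ((lintegral_mono fun x => by
      rw [← ofReal_norm]
      exact ENNReal.ofReal_le_ofReal (le_abs_self _)).trans_lt hg.hasFiniteIntegral).ne
  have hm1 : AEMeasurable (fun x => ENNReal.ofReal (f x)) := hf.aemeasurable.ennreal_ofReal
  have hm2 : AEMeasurable (fun x => ENNReal.ofReal (-f x)) := hf.neg.aemeasurable.ennreal_ofReal
  have := isFiniteMeasure_withDensity (hfin f hf)
  have := isFiniteMeasure_withDensity (hfin _ hf.neg)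
  have hmeas : volume.withDensity (fun x => ENNReal.ofReal (f x))
      = volume.withDensity (fun x => ENNReal.ofReal (-f x)) := by
    refine ext_of_forall_integral_eq_of_IsFiniteMeasure fun φ => ?_
    rw [integral_withDensity_eq_integral_toReal_smul₀ hm1 (ae_of_all _ fun _ => by simp),
      integral_withDensity_eq_integral_toReal_smul₀ hm2 (ae_of_all _ fun _ => by simp),
      ← sub_eq_zero]
    have hbd : ∀ g : S1 → ℝ, Integrable g → Integrable fun x =>
        (ENNReal.ofReal (g x)).toReal • φ x := fun g hg =>
      (hg.pos_part.mul_bdd φ.continuous.aestronglyMeasurable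
        (ae_of_all _ φ.norm_coe_le_norm)).congr (ae_of_all _ fun x => by
          simp [ENNReal.toReal_ofReal', smul_eq_mul])
    rw [← integral_sub (hbd f hf) (hbd (fun x => -f x) hf.neg)]
    have h1 := hL ⟨fun x => (φ x : ℂ), by fun_prop⟩
    change ∫ x, (f x : ℂ) * (φ x : ℂ) = 0 at h1
    have h2 : ∫ x, f x * φ x = 0 := by
      have : ((∫ x, f x * φ x : ℝ) : ℂ) = 0 := by
        rw [← integral_complex_ofReal, ← h1]
        simp
      exact_mod_cast this
    rw [← h2]
    refine integral_congr_ae (ae_of_all _ fun x => ?_)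
    simp only [ENNReal.toReal_ofReal', smul_eq_mul, ← sub_mul]
    rcases le_total 0 (f x) with h | h
    · rw [max_eq_left h, max_eq_right (by linarith), sub_zero]
    · rw [max_eq_right h, max_eq_left (by linarith)]; ring
  have hae := (withDensity_eq_iff hm1 hm2 (hfin f hf)).mp hmeas
  filter_upwards [hae] with x hx
  have h1 := congrArg ENNReal.toReal hx
  rw [ENNReal.toReal_ofReal', ENNReal.toReal_ofReal'] at h1
  rcases le_total 0 (f x) with h | h
  · rw [max_eq_left h, max_eq_right (by linarith)] at h1; exact h1
  · rw [max_eq_right h, max_eq_left (by linarith)] at h1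
    simp only [Pi.zero_apply]
    linarith

theorem fourierC_re_ev {a : Wiener} (ha : Wiener.conjL a = a) (k : ℤ) :
    fourierC (fun x => (Wiener.ev a x).re) k = a k := by
  rw [← Wiener.fourierCoeff_ev a k, fourierC]
  congr 1
  funext x
  exact (Wiener.ev_eq_re ha x).symm

theorem fourierC_sub {f g : S1 → ℝ} (hf : Integrable f) (hg : Integrable g) (k : ℤ) :
    fourierC (fun x => f x - g x) k = fourierC f k - fourierC g k := by
  have hb : ∀ f : S1 → ℝ, Integrable f → Integrable fun x => (f x : ℂ) * fourier (-k) x :=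
    fun f hf => hf.ofReal.mul_bdd (fourier (-k)).continuous.aestronglyMeasurable
      (ae_of_all _ (fourier (-k)).norm_coe_le_norm)
  simp only [fourierC_eq_integral, ← mul_sub]
  rw [← integral_sub (hb f hf) (hb g hg)]
  simp [sub_mul]

theorem conj_fourierC_neg (f : S1 → ℝ) (k : ℤ) : conj (fourierC f (-k)) = fourierC f k := by
  rw [fourierC_eq_integral, fourierC_eq_integral, map_mul, ← integral_conj]
  congr 1
  · simp [Complex.conj_ofNat]
  · refine integral_congr_ae (ae_of_all _ fun x => ?_)
    simp only [map_mul, Complex.conj_ofReal]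
    rw [← fourier_neg, neg_neg]

theorem average_S1 (f : S1 → ℝ) : ⨍ x, f x = (2 * Real.pi)⁻¹ * ∫ x, f x := by
  rw [average_eq, smul_eq_mul, Measure.real, AddCircle.measure_univ,
    ENNReal.toReal_ofReal Real.two_pi_pos.le]

theorem integral_relDev {u₀ : S1 → ℝ} (hint : Integrable u₀) : ∫ x, relDev u₀ u₀ x = 0 := by
  have h : (∫ x, u₀ x) = 2 * Real.pi * ⨍ x, u₀ x := by
    rw [average_S1, mul_inv_cancel_left₀ Real.two_pi_pos.ne']
  unfold relDev
  rw [integral_div, integral_sub hint (integrable_const _), integral_const, h, Measure.real,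
    AddCircle.measure_univ, ENNReal.toReal_ofReal Real.two_pi_pos.le, smul_eq_mul, sub_self,
    zero_div]

theorem wienerNorm_one {f : S1 → ℝ} {a : Wiener} (h : ∀ k : ℤ, a k = Complex.I * k * fourierC f k) :
    wienerNorm 1 f = ‖a‖ₑ := by
  rw [wienerNorm, Wiener.enorm_eq]
  refine tsum_congr fun k => ?_
  rw [h k, ← ofReal_norm]
  simp

theorem wienerNorm_three {f : S1 → ℝ} {a : Wiener} (h : ∀ k : ℤ, a k
    = Complex.I * k * (Complex.I * k * (Complex.I * k * fourierC f k))) :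
    wienerNorm 3 f = ‖a‖ₑ := by
  rw [wienerNorm, Wiener.enorm_eq]
  refine tsum_congr fun k => ?_
  rw [h k, ← ofReal_norm]
  congr 1
  simp only [norm_mul, Complex.norm_I, one_mul, Complex.norm_intCast]
  ring

/-- The derivative of the relative deviation of the initial datum, in the Wiener algebra. -/
theorem exists_initial_derivative {u₀ : S1 → ℝ} (hint : Integrable u₀)
    (hw₀ : MemWiener 1 (relDev u₀ u₀)) : ∃ p₀ : Wiener, ‖p₀‖ₑ = wienerNorm 1 (relDev u₀ u₀) ∧
      Wiener.conjL p₀ = p₀ ∧ p₀ 0 = 0 ∧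
      relDev u₀ u₀ =ᵐ[volume] fun x => (Wiener.ev (Wiener.antideriv p₀) x).re := by
  set c := fourierC (relDev u₀ u₀)
  have hs : Summable fun k : ℤ => ‖Complex.I * k * c k‖ := by
    refine summable_of_tsum_enorm_ne_top (ne_of_lt (lt_of_eq_of_lt ?_ hw₀.2))
    refine tsum_congr fun k => ?_
    rw [← ofReal_norm]
    simp [c]
  set p₀ := Wiener.ofCoeff fun k => Complex.I * k * c k
  have hp : ∀ k, p₀ k = Complex.I * k * c k := Wiener.ofCoeff_apply hs
  have hr : Wiener.conjL p₀ = p₀ := Wiener.ext fun k => by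
    rw [Wiener.conjL_apply, hp, hp, map_mul, conj_fourierC_neg]
    simp [c]
  have hr' := Wiener.conjL_antideriv hr
  refine ⟨p₀, (wienerNorm_one hp).symm, hr, by rw [hp]; simp, ?_⟩
  have hi : Integrable fun x => (Wiener.ev (Wiener.antideriv p₀) x).re :=
    integrable_S1 (by fun_prop)
  have h := ae_eq_zero_of_fourierC (hw₀.1.sub hi) fun k => by
    refine (fourierC_sub hw₀.1 hi k).trans ?_
    rw [fourierC_re_ev hr', Wiener.antideriv_apply, hp]
    rcases eq_or_ne k 0 with rfl | hk
    · rw [fourierC_eq_integral]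
      simp only [neg_zero, fourier_zero, mul_one]
      rw [integral_complex_ofReal, integral_relDev hint]
      simp
    · rw [inv_mul_cancel_left₀ (Wiener.I_mul_ne_zero hk), sub_self]
  filter_upwards [h] with x hx
  exact sub_eq_zero.mp hx

/-! ### Change of the time scale, restriction of the time interval -/

theorem map_div_timeMeasure {m : ℝ} (hm : 0 < m) :
    Measure.map (fun t : ℝ => t / m) timeMeasure = ENNReal.ofReal m • timeMeasure := by
  have h1 : (fun t : ℝ => t / m) = (· * m⁻¹) := by funext t; rw [div_eq_mul_inv]
  have h2 : Ioi (0 : ℝ) = (· * m⁻¹) ⁻¹' Ioi (0 : ℝ) := by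
    ext t; simp [hm]
  rw [h1, timeMeasure]
  conv_lhs => rw [h2]
  rw [← Measure.restrict_map (by fun_prop) measurableSet_Ioi,
    Real.map_volume_mul_right (inv_ne_zero hm.ne'), inv_inv, abs_of_pos hm, Measure.restrict_smul]

theorem ae_div_timeMeasure {m : ℝ} (hm : 0 < m) {P : ℝ → Prop} (h : ∀ᵐ t ∂timeMeasure, P t) :
    ∀ᵐ t ∂timeMeasure, P (t / m) := by
  refine ae_of_ae_map (f := fun t : ℝ => t / m) (by fun_prop) ?_
  rw [map_div_timeMeasure hm]
  exact Measure.ae_smul_measure h _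

theorem lintegral_div_timeMeasure {m : ℝ} (hm : 0 < m) {f : ℝ → ℝ≥0∞}
    (hf : AEMeasurable f timeMeasure) :
    ∫⁻ t, f (t / m) ∂timeMeasure = ENNReal.ofReal m * ∫⁻ t, f t ∂timeMeasure := by
  rw [← smul_eq_mul, ← lintegral_smul_measure, ← map_div_timeMeasure hm,
    lintegral_map' ?_ (by fun_prop)]
  rw [map_div_timeMeasure hm]
  exact hf.smul_measure _

theorem timeIoo_top : timeIoo ⊤ = Ioi 0 := by ext t; simp [timeIoo]

theorem mem_timeIco_top {t : ℝ} : t ∈ timeIco ⊤ ↔ 0 ≤ t := by simp [timeIco]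

theorem timeIco_subset_top (T : ℝ≥0∞) : timeIco T ⊆ timeIco ⊤ := fun _ h => mem_timeIco_top.mpr h.1

theorem measurableSet_timeIoo (T : ℝ≥0∞) : MeasurableSet (timeIoo T) :=
  measurableSet_Ioi.inter (measurableSet_lt ENNReal.measurable_ofReal measurable_const)

theorem IsPositiveSolution.restrict {u₀ : S1 → ℝ} {u : ℝ → S1 → ℝ}
    (hu : IsPositiveSolution u₀ ⊤ u) (T : ℝ≥0∞) : IsPositiveSolution u₀ T u where
  pos t ht := hu.pos t (timeIco_subset_top T ht)
  continuousOn := hu.continuousOn.mono (prod_mono_left (timeIco_subset_top T))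
  differentiable t ht := hu.differentiable t (timeIco_subset_top T ht)
  continuousOn_xDeriv := hu.continuousOn_xDeriv.mono (prod_mono_left (timeIco_subset_top T))
  initial := hu.initial
  equation φ hφ t ht := hu.equation φ hφ t (timeIco_subset_top T ht)

theorem MemLpWiener.restrict {p T : ℝ≥0∞} {α : ℕ} {w v : ℝ → S1 → ℝ} (hw : MemLpWiener p ⊤ α w)
    (h : ∀ t ∈ timeIoo T, v t = w t) : MemLpWiener p T α v := by
  have hle : volume.restrict (timeIoo T) ≤ volume.restrict (timeIoo ⊤) :=
    Measure.restrict_mono (by rw [timeIoo_top]; exact fun t ht => ht.1) le_rfl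
  have hae : ∀ᵐ t ∂volume.restrict (timeIoo T), v t = w t :=
    (ae_restrict_mem (measurableSet_timeIoo T)).mono h
  refine ⟨fun k => ?_, ?_, ?_⟩
  · refine ((hw.aemeasurable k).mono_measure hle).congr ?_
    filter_upwards [hae] with t ht
    rw [ht]
  · filter_upwards [hae, ae_mono hle hw.mem] with t ht h
    rwa [ht]
  · rw [eLpNorm_congr_ae (g := fun t => wienerNorm α (w t)) (by
      filter_upwards [hae] with t ht
      rw [ht])]
    exact (eLpNorm_mono_measure _ hle).trans_lt hw.norm_lt_top

/-! ### Existence and regularity -/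

open Wiener in
theorem exists_solution (u₀ : S1 → ℝ) (hint : Integrable u₀) (hmean : 0 < ⨍ x, u₀ x)
    (hw₀ : MemWiener 1 (relDev u₀ u₀))
    (hsmall : wienerNorm 1 (relDev u₀ u₀) < ENNReal.ofReal (1 / 10)) :
    ∃ u : ℝ → S1 → ℝ, IsPositiveSolution u₀ ⊤ u ∧
      MemLpWiener ⊤ ⊤ 1 (fun t => relDev u₀ (u t)) ∧
      MemLpWiener 1 ⊤ 3 (fun t => relDev u₀ (u t)) := by
  obtain ⟨p₀, hn, hr, h0, hinit⟩ := exists_initial_derivative hint hw₀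
  have hp₀ : ‖p₀‖ ≤ 1 / 10 := by
    rw [← hn, ← ofReal_norm] at hsmall
    exact ((ENNReal.ofReal_lt_ofReal_iff (by norm_num)).mp hsmall).le
  obtain ⟨p, pxx, hpc, hp0, hpb, heq, hpxx, hpxx'⟩ := exists_profile hp₀ hr h0
  set m := ⨍ x, u₀ x with hm
  have hdiv : ∀ {t : ℝ}, 0 ≤ t → 0 ≤ t / m := fun ht => div_nonneg ht hmean.le
  set W : ℝ → S1 → ℝ := fun t x => (ev (antideriv (p (t / m))) x).re with hW
  set u : ℝ → S1 → ℝ := fun t x => m * (1 + W t x) with hu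
  have hrel : ∀ t, relDev u₀ (u t) = W t := fun t => by
    funext x
    rw [relDev, ← hm, hu]
    field_simp
    ring
  have hpc' : ContinuousOn (fun t => p (t / m)) (Ici 0) :=
    hpc.comp (by fun_prop) fun t ht => hdiv ht
  have hderiv : ∀ t, 0 ≤ t → ∀ y : ℝ, HasDerivAt (fun z : ℝ => u t (z : S1))
      (m * (ev (p (t / m)) (y : S1)).re) y := fun t ht y =>
    ((Complex.reCLM.hasFDerivAt.comp_hasDerivAt y
      ((isDeriv_antideriv (hpb _ (hdiv ht)).2.2).hasDerivAt y)).const_add 1).const_mul m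
  have hx : ∀ t, 0 ≤ t → xDeriv (u t) = fun x => m * (ev (p (t / m)) x).re := fun t ht =>
    xDeriv_eq (hderiv t ht)
  have hjoint : ∀ L : Wiener →L[ℝ] C(S1, ℂ), ContinuousOn (fun q : ℝ × S1 => L (p (q.1 / m)) q.2)
      (timeIco ⊤ ×ˢ univ) := fun L => by
    have h1 : ContinuousOn (fun q : ℝ × S1 => (L (p (q.1 / m)), q.2)) (timeIco ⊤ ×ˢ univ) :=
      (L.continuous.comp_continuousOn (hpc'.comp continuousOn_fst
        fun q hq => mem_timeIco_top.mp hq.1)).prodMk continuousOn_snd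
    exact continuous_eval.comp_continuousOn h1
  have hflux : ∀ t, 0 ≤ t → ∀ x, Real.arctan (xDeriv (u t) x / u t x) = flux (p (t / m)) x :=
    fun t ht x => by rw [hx t ht, hu, flux, mul_div_mul_left _ _ hmean.ne']
  have hcoeff : ∀ t, 0 ≤ t → ∀ k, fourierC (W t) k = antideriv (p (t / m)) k := fun t ht k =>
    fourierC_re_ev (conjL_antideriv (hpb _ (hdiv ht)).2.1) k
  have hcoeff' : ∀ t, 0 ≤ t → ∀ k : ℤ, p (t / m) k = Complex.I * k * fourierC (W t) k :=
    fun t ht k => by rw [hcoeff t ht, isDeriv_antideriv (hpb _ (hdiv ht)).2.2]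
  have hn1 : ∀ t, 0 ≤ t → wienerNorm 1 (W t) = ‖p (t / m)‖ₑ := fun t ht =>
    wienerNorm_one (hcoeff' t ht)
  have hn3 : ∀ᵐ t ∂timeMeasure, wienerNorm 3 (W t) = ‖pxx (t / m)‖ₑ := by
    filter_upwards [ae_div_timeMeasure hmean hpxx', ae_restrict_mem measurableSet_Ioi] with t h ht
    exact wienerNorm_three fun k => by rw [h k, hcoeff' t (mem_Ioi.mp ht).le]
  have hWi : ∀ t, Integrable (W t) := fun t => integrable_S1 (by fun_prop)
  have hmeas : ∀ k : ℤ, AEMeasurable (fun t => fourierC (W t) k) timeMeasure := fun k => by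
    have h1 : ContinuousOn (fun t => coeffL k (antideriv (p (t / m)))) (Ioi 0) :=
      ((coeffL k).continuous.comp antideriv.continuous).comp_continuousOn
        (hpc'.mono Ioi_subset_Ici_self)
    refine (h1.aemeasurable measurableSet_Ioi).congr ?_
    filter_upwards [ae_restrict_mem measurableSet_Ioi] with t ht
    rw [coeffL_apply, hcoeff t (mem_Ioi.mp ht).le]
  refine ⟨u, ⟨?_, ?_, ?_, ?_, ?_, ?_⟩, ?_, ?_⟩
  · exact fun t ht x => mul_pos hmean (one_add_re_pos (hpb _ (hdiv ht.1)).1 x)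
  · exact continuousOn_const.mul (continuousOn_const.add
      (Complex.continuous_re.comp_continuousOn (hjoint ((ev.restrictScalars ℝ).comp antideriv))))
  · intro t ht x
    obtain ⟨y, rfl⟩ := QuotientAddGroup.mk_surjective x
    exact (S1.hasDerivAt_iff.mpr (hderiv t ht.1 y)).differentiableAt
  · refine ContinuousOn.congr (f := fun q : ℝ × S1 => m * (ev (p (q.1 / m)) q.2).re) ?_
      fun q hq => by rw [hx q.1 hq.1.1]
    exact continuousOn_const.mul
      (Complex.continuous_re.comp_continuousOn (hjoint (ev.restrictScalars ℝ)))
  · filter_upwards [hinit] with x hx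
    simp only [hu, hW, zero_div, hp0, ← hx, relDev, ← hm]
    field_simp
    ring
  · intro φ hφ t ht
    have hd : ∀ y : ℝ, HasDerivAt (fun z : ℝ => φ (z : S1)) (xDeriv φ (y : S1)) y := fun y => by
      have h1 := (hφ.differentiable (by simp) y).hasDerivAt
      have h2 : xDeriv φ (y : S1) = _ := (S1.hasDerivAt_iff.mpr h1).deriv
      rwa [h2]
    have hφ' : Continuous (xDeriv φ) := by
      refine continuous_coinduced_dom.mpr ?_
      have h1 := hφ.continuous_deriv (by simp)
      convert h1 using 1
      funext y
      exact (hd y).deriv.symm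
    have hφc := continuous_of_hasDerivAt hd
    have hφi : Integrable φ := integrable_S1 hφc
    have e1 := heq φ (xDeriv φ) hφ' hd (t / m) (hdiv ht.1)
    have e2 : ∀ V : S1 → ℝ, Continuous V →
        ∫ x, m * (1 + V x) * φ x = m * ((∫ x, φ x) + ∫ x, V x * φ x) := fun V hV => by
      rw [← integral_add hφi (integrable_S1 (by fun_prop)), ← integral_const_mul]
      refine integral_congr_ae (ae_of_all _ fun x => ?_)
      simp only; ring
    have e3 : ∫ x, u₀ x * φ x
        = ∫ x, m * (1 + (ev (antideriv p₀) x).re) * φ x := by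
      refine integral_congr_ae ?_
      filter_upwards [hinit] with x hx
      simp only [← hx, relDev, ← hm]
      field_simp
      ring
    have e4 : ∫ s in (0 : ℝ)..t, ∫ x, Real.arctan (xDeriv (u s) x / u s x) * xDeriv φ x
        = m * ∫ s in (0 : ℝ)..t / m, ∫ x, flux (p s) x * xDeriv φ x := by
      have h1 := intervalIntegral.integral_comp_div (a := 0) (b := t)
        (fun s => ∫ x, flux (p s) x * xDeriv φ x) hmean.ne'
      rw [zero_div, smul_eq_mul] at h1
      rw [← h1]
      refine intervalIntegral.integral_congr fun s hs => ?_
      rw [uIcc_of_le ht.1] at hs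
      simp only [hflux s hs.1]
    rw [e3, e4, e2 _ (by fun_prop), e2 _ (by fun_prop), e1]
    ring
  · simp only [hrel]
    refine ⟨fun k => ?_, ?_, ?_⟩ <;> rw [timeIoo_top]
    · exact hmeas k
    · filter_upwards [ae_restrict_mem measurableSet_Ioi] with t ht
      refine ⟨hWi t, ?_⟩
      rw [hn1 t (mem_Ioi.mp ht).le]
      exact enorm_lt_top
    · rw [eLpNorm_exponent_top]
      refine lt_of_le_of_lt (essSup_le_of_ae_le (ENNReal.ofReal (1 / 8)) ?_) ENNReal.ofReal_lt_top
      filter_upwards [ae_restrict_mem measurableSet_Ioi] with t ht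
      have ht := (mem_Ioi.mp ht).le
      rw [enorm_eq_self, hn1 t ht, ← ofReal_norm]
      exact ENNReal.ofReal_le_ofReal (hpb _ (hdiv ht)).1
  · simp only [hrel]
    refine ⟨fun k => ?_, ?_, ?_⟩ <;> rw [timeIoo_top]
    · exact hmeas k
    · filter_upwards [hn3] with t ht
      refine ⟨hWi t, ?_⟩
      rw [ht]
      exact enorm_lt_top
    · rw [eLpNorm_one_eq_lintegral_enorm]
      simp only [enorm_eq_self]
      rw [lintegral_congr_ae hn3,
        lintegral_div_timeMeasure hmean (f := fun t => ‖pxx t‖ₑ) hpxx.aestronglyMeasurable.enorm]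
      exact ENNReal.mul_lt_top ENNReal.ofReal_lt_top hpxx.hasFiniteIntegral

end ArctanDiffusion

end

theorem theorem6 (u₀ : S1 → ℝ) (hint : Integrable u₀) (hmean : 0 < ⨍ x, u₀ x)
    (hw₀ : MemWiener 1 (relDev u₀ u₀))
    (hsmall : wienerNorm 1 (relDev u₀ u₀) < ENNReal.ofReal (1 / 10)) :
    (∃ u : ℝ → S1 → ℝ, IsPositiveSolution u₀ ⊤ u) ∧
    (∀ (T : ℝ≥0∞) (u v : ℝ → S1 → ℝ), 0 < T →
      IsPositiveSolution u₀ T u → IsPositiveSolution u₀ T v → ∀ t ∈ timeIco T, u t = v t) ∧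
    (∀ (T : ℝ≥0∞) (u : ℝ → S1 → ℝ), 0 < T → IsPositiveSolution u₀ T u →
      MemLpWiener ⊤ T 1 (fun t => relDev u₀ (u t)) ∧
      MemLpWiener 1 T 3 (fun t => relDev u₀ (u t))) := by
  obtain ⟨u, hu, h1, h3⟩ := exists_solution u₀ hint hmean hw₀ hsmall
  refine ⟨⟨u, hu⟩, fun T u v _ hu hv t ht => hu.unique hv ht, fun T v _ hv => ?_⟩
  have h : ∀ t ∈ timeIoo T, relDev u₀ (v t) = relDev u₀ (u t) := fun t ht => by
    rw [hv.unique (hu.restrict T) ⟨ht.1.le, ht.2⟩]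
  exact ⟨h1.restrict h, h3.restrict h⟩
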